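/- **Setting.** A UAV monitors two locations $A,B$ in discrete time; for $l\in\{A,B\}$ let $l'$ denote the other location. Measurements $Y_{l,t}\in\mathbb R^s$ are independent over locations and times. At $l$ they have law $f_l$ before the change time $\nu_l$ and law $g_l$ from $\nu_l$ on; a change occurs in at most one location. Here $f_l\ne g_l$ are mutually absolutely continuous probability laws whose log-likelihood ratio $Z_l=\log\frac{g_l(Y_l)}{f_l(Y_l)}$ has finite second moments under $f_l$ and $g_l$. $\mathbb E_\infty$ is expectation with no change, $\mathbb P_\nu^l,\mathbb E_\nu^l$ refer to a change at $l$ at time $\nu$ (and none at $l'$); $D(\cdot\|\cdot)$ is the Kullback–Leibler divergence, $q_l=\mathbb P_0^l(Z_l>0)$ and $\bar q_l=1-q_l$. **LS-CD with $n_A=n_B=n\ge 1$**, thresholds $\gamma_A,\gamma_B>0$ and integer travel time $\tau\ge0$. The UAV starts at one of the locations. While it senses at $l$ it updates $W_l\leftarrow\max\{W_l+Z_l(t),0\}$, starting from $W_l=0$. An SPRT cycle ends when $W_l$ leaves $(0,\gamma_l)$. If $W_l\ge\gamma_l$, a change at $l$ is declared and the sojourn at $l$ ends; if $W_l=0$,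 the next cycle starts, and the sojourn ends once $n$ cycles of it have returned to $0$. When a sojourn ends the UAV travels for $\tau$ slots to the other location and proceeds there in the same way. $T'_l$ is the first time a change at $l$ is declared, $\mathcal I_l^{\nu-1}$ is the $\sigma$-algebra generated by the (time-stamped) measurements gathered by the UAV at $l$ before time $\nu$, and $$\mathrm{WADD}_l=\sup_{\nu}\ \operatorname{ess\,sup}\ \mathbb E_\nu^l\big[(T'_l-\nu)^+\mid\mathcal I_l^{\nu-1}\big].$$ For $w\in[0,\gamma_{l'})$ let $\tau_{l'}^{(w)}$ be the remaining sojourn time at $l'$ when the UAV is there in its first SPRT cycle with $W_{l'}=w$; put $\tau_{l'}^{(\gamma_{l'})}=0$ (sojourn over). For $w^*\in[0,\gamma_{l'}]$ put $$C_1=\tau\,\frac{1+\bar q_l^{\,n}}{1-\bar q_l^{\,n}}+\Big(1+\frac{\mathbb E_\infty(Z_{l'}\mathbf 1_{\{Z_{l'}\ge0\}})}{D(f_{l'}\|g_{l'})}\Big)\Big(\frac{n\bar q_l^{\,n}}{1-\bar q_l^{\,n}}+(n-1)\big(1+e^{-w^*}-\tfrac12e^{-D(f_{l'}\|g_{l'})}\big)\Big),$$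 $$C_2=\frac{2\tau+n+n\,\mathbb E_\infty(Z_{l'}\mathbf 1_{\{Z_{l'}\ge0\}})/D(f_{l'}\|g_{l'})}{1-\bar q_l^{\,n}},\qquad C'=\max\Big\{C_1+\frac{\gamma_{l'}}{D(f_{l'}\|g_{l'})},\,C_2\Big\}.$$ **Theorem.** For given $f_A,f_B,g_A,g_B$, $\tau$ and $n$ there is a constant $K$ (the $O(1)$ term; it depends neither on the thresholds $\gamma_A,\gamma_B$, nor on $w^*$, nor on $l$, nor on the starting location) such that for all $\gamma_A,\gamma_B>0$ and both locations $l$: 1. if $w^*\in(0,\gamma_{l'})$ maximizes $w\mapsto\mathbb E_\infty(\tau_{l'}^{(w)})$ over $(0,\gamma_{l'})$, then $$\mathrm{WADD}_l\le\frac{\gamma_l}{D(g_l\|f_l)}+C'+K;$$ 2. if $w^*$ maximizes $w\mapsto\mathbb E_\infty(\tau_{l'}^{(w)})$ over $[0,\gamma_{l'}]$ and $w^*\notin(0,\gamma_{l'})$, then $$\mathrm{WADD}_l\le\frac{\gamma_l}{D(g_l\|f_l)}+C_2+K.$$ -/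

import Mathlib

open MeasureTheory Set
open scoped ENNReal

namespace UAV

/-- The two spatially separated locations. -/
inductive Loc
  | A
  | B
  deriving DecidableEq

/-- The location different from `l`. -/
def Loc.other : Loc → Loc
  | .A => .B
  | .B => .A

/-- A vector measurement in `ℝ^s`. -/
abbrev Meas (s : ℕ) : Type := EuclideanSpace ℝ (Fin s)

/-- Sample space: `ω (l, t)` is the measurement `Y_{l,t}` available at location `l` in time
slot `t`. Time slots are numbered `0, 1, 2, …`. -/
abbrev Path (s : ℕ) : Type := Loc × ℕ → Meas s

/-- The data of the monitoring problem and of the LS-CD algorithm: pre-change distributions `f`,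
post-change distributions `g`, the travel time `τ` (in slots) between the locations, the number
`n l` of consecutive SPRT cycles at `l` that have to return to zero before the UAV leaves `l`,
and the detection thresholds `γ`. -/
structure LSCD (s : ℕ) where
  f : Loc → Measure (Meas s)
  g : Loc → Measure (Meas s)
  τ : ℕ
  n : Loc → ℕ
  γ : Loc → ℝ

/-- State of the UAV at the beginning of a time slot. -/
structure State where
  /-- the location where the UAV is, or (while it travels) the location it travels to -/
  loc : Loc
  /-- number of travel slots left before sensing at `loc` can begin -/
  transit : ℕ
  /-- number of SPRT cycles of the current sojourn that have already returned to zero -/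
  cycles : ℕ
  /-- the statistic `W` of the current SPRT at `loc` -/
  stat : ℝ

/-- The UAV starts sensing at `l` with the statistic at zero. -/
def State.fresh (l : Loc) : State := ⟨l, 0, 0, 0⟩

namespace LSCD

variable {s : ℕ} (S : LSCD s)

/-- The log-likelihood ratio `Z_l(y) = log (dg_l/df_l)(y)`; it is `log (g_l(y) / f_l(y))` when
`f_l`, `g_l` are given by densities. -/
noncomputable def Z (l : Loc) (y : Meas s) : ℝ := llr (S.g l) (S.f l) y

/-- The UAV senses at `l` in a slot that begins in state `x`. -/
def SensesAt (x : State) (l : Loc) : Prop := x.loc = l ∧ x.transit = 0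

/-- The value `max (W + Z) 0` of the statistic after the measurement `y` at the UAV's location. -/
noncomputable def update (x : State) (y : Meas s) : ℝ := max (x.stat + S.Z x.loc y) 0

/-- State of a UAV that has just left the location `x.loc` for the other one. -/
def depart (x : State) : State := ⟨x.loc.other, S.τ, 0, 0⟩

open Classical in
/-- One time slot of LS-CD; `y l` is the measurement available at `l` in that slot.
While travelling, one travel slot passes. Otherwise the statistic is updated, and
* if it reaches the threshold, a change is declared and the sojourn ends;
* if it returns to zero, the SPRT cycle ends, and the sojourn ends if this was the `n`-th cycle;
* otherwise the current SPRT cycle goes on. -/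
noncomputable def step (x : State) (y : Loc → Meas s) : State :=
  if x.transit ≠ 0 then { x with transit := x.transit - 1 }
  else if S.γ x.loc ≤ S.update x (y x.loc) then S.depart x
  else if S.update x (y x.loc) ≤ 0 then
    if S.n x.loc ≤ x.cycles + 1 then S.depart x
    else { x with cycles := x.cycles + 1, stat := 0 }
  else { x with stat := S.update x (y x.loc) }

/-- State at the beginning of slot `t`, when the state at the beginning of slot `0` is `x`. -/
noncomputable def traj (x : State) (ω : Path s) : ℕ → State
  | 0 => x
  | t + 1 => S.step (traj x ω t) (fun l => ω (l, t))

/-- In slot `t` the statistic at `l` reaches the threshold `γ_l`. -/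
def Alarm (x : State) (l : Loc) (ω : Path s) (t : ℕ) : Prop :=
  SensesAt (S.traj x ω t) l ∧ S.γ l ≤ S.update (S.traj x ω t) (ω (l, t))

/-- The stopping time `T'_l`: the first time at which a change at `l` has been declared. The
measurement of slot `t` enters the statistic of time `t + 1`. It is `∞` if this never happens. -/
noncomputable def alarmTime (x : State) (l : Loc) (ω : Path s) : ℕ∞ :=
  ⨅ (t : ℕ) (_ : S.Alarm x l ω t), ((t + 1 : ℕ) : ℕ∞)

/-- The detection delay `(T'_l - ν)^+`. -/
noncomputable def delay (x : State) (l : Loc) (ν : ℕ) (ω : Path s) : ℝ≥0∞ :=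
  (S.alarmTime x l ω : ℝ≥0∞) - (ν : ℝ≥0∞)

/-- Law of the measurements when the change occurs at location `l` in slot `ν` and no change
occurs at the other location: independent measurements, `g l` at `l` from slot `ν` on and the
pre-change distribution otherwise. -/
noncomputable def lawChange (l : Loc) (ν : ℕ) : Measure (Path s) :=
  Measure.infinitePi fun p : Loc × ℕ => if p.1 = l ∧ ν ≤ p.2 then S.g l else S.f p.1

/-- Law of the measurements when no change occurs. -/
noncomputable def lawNoChange : Measure (Path s) :=
  Measure.infinitePi fun p : Loc × ℕ => S.f p.1

/-- The information `I_l^{ν-1}`: the `σ`-algebra generated by the measurements that the UAV has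
gathered at `l` in the slots before `ν`. -/
@[reducible] def history (x : State) (l : Loc) (ν : ℕ) : MeasurableSpace (Path s) :=
  MeasurableSpace.generateFrom
    {E | ∃ t < ν, ∃ B : Set (Meas s), MeasurableSet B ∧
      E = {ω | SensesAt (S.traj x ω t) l ∧ ω (l, t) ∈ B}}

/-- Lorden's worst-case average detection delay at `l`, for a UAV with initial state `x`:
`sup_ν ess sup E_ν^l[(T'_l - ν)^+ | I_l^{ν-1}]`. -/
noncomputable def WADD (x : State) (l : Loc) : ℝ≥0∞ :=
  ⨆ ν : ℕ, essSup (condLExp (S.history x l ν) (S.lawChange l ν) (S.delay x l ν))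
    (S.lawChange l ν)

/-- Number of slots until the UAV leaves `l`, when it is in its first SPRT cycle at `l` with
statistic `w`. The sojourn is already over if `w ≥ γ_l`. -/
noncomputable def remSojourn (l : Loc) (w : ℝ) (ω : Path s) : ℕ∞ :=
  open Classical in
  if S.γ l ≤ w then 0
  else ⨅ (t : ℕ) (_ : (S.traj ⟨l, 0, 0, w⟩ ω t).loc ≠ l), (t : ℕ∞)

/-- The mean remaining sojourn time `E_∞(τ_l^{(w)})`. -/
noncomputable def meanRemSojourn (l : Loc) (w : ℝ) : ℝ≥0∞ :=
  ∫⁻ ω, (S.remSojourn l w ω : ℝ≥0∞) ∂S.lawNoChange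

/-- `D(g_l ‖ f_l)`. -/
noncomputable def Dgf (l : Loc) : ℝ := (InformationTheory.klDiv (S.g l) (S.f l)).toReal

/-- `D(f_l ‖ g_l)`. -/
noncomputable def Dfg (l : Loc) : ℝ := (InformationTheory.klDiv (S.f l) (S.g l)).toReal

/-- `1 - q_l`, where `q_l = P_0^l(Z_l > 0)`. -/
noncomputable def qbar (l : Loc) : ℝ := 1 - (S.g l).real {y | 0 < S.Z l y}

/-- `E_∞(Z_l 1_{Z_l ≥ 0})`. -/
noncomputable def meanPos (l : Loc) : ℝ := ∫ y in {y | 0 ≤ S.Z l y}, S.Z l y ∂S.f l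

/-- The constant `C_1`, with `w` in the place of `w*`. -/
noncomputable def C₁ (l : Loc) (w : ℝ) : ℝ :=
  S.τ * ((1 + S.qbar l ^ S.n l) / (1 - S.qbar l ^ S.n l))
    + (1 + S.meanPos l.other / S.Dfg l.other)
      * (S.n l * S.qbar l ^ S.n l / (1 - S.qbar l ^ S.n l)
        + ((S.n l : ℝ) - 1) * (1 + Real.exp (-w) - 1 / 2 * Real.exp (-S.Dfg l.other)))

/-- The constant `C_2`. -/
noncomputable def C₂ (l : Loc) : ℝ :=
  (2 * S.τ + S.n l + S.n l * S.meanPos l.other / S.Dfg l.other) / (1 - S.qbar l ^ S.n l)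

/-- `C' = max {C_1 + γ_{l'} / D(f_{l'} ‖ g_{l'}), C_2}`. -/
noncomputable def C' (l : Loc) (w : ℝ) : ℝ :=
  max (S.C₁ l w + S.γ l.other / S.Dfg l.other) (S.C₂ l)

end LSCD

end UAV

namespace UAV
namespace LSCD

theorem measurable_iInf_prop {s : ℕ} {p : Path s → Prop} (hp : MeasurableSet {ω | p ω})
    (c : ℝ≥0∞) : Measurable fun ω => ⨅ (_ : p ω), c := by
  classical
  have h : (fun ω => ⨅ (_ : p ω), c) = fun ω => if p ω then c else ⊤ :=
    funext fun ω => iInf_eq_if _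
  rw [h]
  exact Measurable.ite hp measurable_const measurable_const

open Classical in
theorem measurable_ite_prop {s : ℕ} {β : Type} [MeasurableSpace β] {p : Path s → Prop}
    {u v : Path s → β} (hp : MeasurableSet {ω | p ω}) (hu : Measurable u) (hv : Measurable v) :
    Measurable fun ω => if p ω then u ω else v ω :=
  Measurable.ite hp hu hv

theorem measurable_traj {s : ℕ} (S : LSCD s) (x : State) (t : ℕ) :
    (∀ l, MeasurableSet {ω | (S.traj x ω t).loc = l}) ∧
    (∀ k, MeasurableSet {ω | (S.traj x ω t).transit = k}) ∧
    (∀ k, MeasurableSet {ω | (S.traj x ω t).cycles = k}) ∧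
    Measurable (fun ω => (S.traj x ω t).stat) ∧
    Measurable (fun ω => S.update (S.traj x ω t) (ω ((S.traj x ω t).loc, t))) := by
  let _ : MeasurableSpace Loc := ⊤
  have hcL : Countable Loc := ⟨fun l => if l = .A then 0 else 1, by
    intro a b; cases a <;> cases b <;> simp⟩
  have hL : ∀ h : Path s → Loc, (∀ l, MeasurableSet {ω | h ω = l}) → Measurable h :=
    fun h hh => measurable_to_countable' hh
  have hN : ∀ h : Path s → ℕ, (∀ l, MeasurableSet {ω | h ω = l}) → Measurable h :=
    fun h hh => measurable_to_countable' hh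
  have hU : ∀ t, (∀ l, MeasurableSet {ω | (S.traj x ω t).loc = l}) →
      Measurable (fun ω => (S.traj x ω t).stat) →
      Measurable (fun ω => S.update (S.traj x ω t) (ω ((S.traj x ω t).loc, t))) := by
    intro t h1 h2
    have hZ : Measurable fun p : Loc × Path s => S.Z p.1 (p.2 (p.1, t)) :=
      measurable_from_prod_countable_right fun l =>
        (measurable_llr (S.g l) (S.f l)).comp (measurable_pi_apply (l, t))
    exact (h2.add (hZ.comp ((hL _ h1).prodMk measurable_id))).max measurable_const
  induction t with
  | zero =>
    have h : (∀ l, MeasurableSet {ω : Path s | (S.traj x ω 0).loc = l}) ∧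
        Measurable (fun ω : Path s => (S.traj x ω 0).stat) :=
      ⟨fun l => MeasurableSet.const (x.loc = l), measurable_const (a := x.stat)⟩
    exact ⟨h.1, fun k => MeasurableSet.const (x.transit = k),
      fun k => MeasurableSet.const (x.cycles = k), h.2,
      hU 0 h.1 h.2⟩
  | succ t ih =>
    obtain ⟨h1, h2, h3, h4, h5⟩ := ih
    have m1 := hL _ h1
    have m2 := hN _ h2
    have m3 := hN _ h3
    have c1 : MeasurableSet {ω | (S.traj x ω t).transit ≠ 0} := (h2 0).compl
    have c2 : MeasurableSet {ω | S.γ (S.traj x ω t).loc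
        ≤ S.update (S.traj x ω t) (ω ((S.traj x ω t).loc, t))} :=
      measurableSet_le ((measurable_from_top (f := S.γ)).comp m1) h5
    have c3 : MeasurableSet {ω | S.update (S.traj x ω t) (ω ((S.traj x ω t).loc, t)) ≤ 0} :=
      measurableSet_le h5 measurable_const
    have c4 : MeasurableSet {ω | S.n (S.traj x ω t).loc ≤ (S.traj x ω t).cycles + 1} :=
      measurableSet_le ((measurable_from_top (f := S.n)).comp m1) (m3.add_const 1)
    have key : ∀ {β : Type} [MeasurableSpace β] (c : State → β),
        Measurable (fun ω => c { S.traj x ω t with transit := (S.traj x ω t).transit - 1 }) →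
        Measurable (fun ω => c (S.depart (S.traj x ω t))) →
        Measurable (fun ω => c { S.traj x ω t with
          cycles := (S.traj x ω t).cycles + 1, stat := 0 }) →
        Measurable (fun ω => c { S.traj x ω t with
          stat := S.update (S.traj x ω t) (ω ((S.traj x ω t).loc, t)) }) →
        Measurable (fun ω => c (S.traj x ω (t + 1))) := by
      intro β _ c k1 k2 k3 k4
      have := measurable_ite_prop c1 k1 (measurable_ite_prop c2 k2 (measurable_ite_prop c3
        (measurable_ite_prop c4 k2 k3) k4))
      convert this using 2 with ω
      simp only [traj, step]
      split_ifs <;> rfl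
    have r1 : Measurable (fun ω => (S.traj x ω (t + 1)).loc) :=
      key State.loc m1 ((measurable_from_top (f := Loc.other)).comp m1) m1 m1
    have r2 : Measurable (fun ω => (S.traj x ω (t + 1)).transit) :=
      key State.transit ((measurable_from_top (f := fun k : ℕ => k - 1)).comp m2)
        measurable_const m2 m2
    have r3 : Measurable (fun ω => (S.traj x ω (t + 1)).cycles) :=
      key State.cycles m3 measurable_const (m3.add_const 1) m3
    have r4 : Measurable (fun ω => (S.traj x ω (t + 1)).stat) :=
      key State.stat h4 measurable_const measurable_const h5
    have q1 : ∀ l, MeasurableSet {ω | (S.traj x ω (t + 1)).loc = l} :=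
      fun l => r1 (MeasurableSpace.measurableSet_top (s := {l}))
    exact ⟨q1, fun k => r2 (measurableSet_singleton k), fun k => r3 (measurableSet_singleton k),
      r4, hU _ q1 r4⟩

/-- The history is a sub-`σ`-algebra, so that conditional expectations given it make sense. -/
theorem history_le {s : ℕ} (S : LSCD s) (x : State) (l : Loc) (ν : ℕ) :
    S.history x l ν ≤ MeasurableSpace.pi := by
  refine MeasurableSpace.generateFrom_le ?_
  rintro E ⟨t, -, B, hB, rfl⟩
  obtain ⟨h1, h2, -, -, -⟩ := S.measurable_traj x t
  exact ((h1 l).inter (h2 0)).inter (measurable_pi_apply (l, t) hB)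

/-- The detection delay is a random variable. -/
theorem measurable_delay {s : ℕ} (S : LSCD s) (x : State) (l : Loc) (ν : ℕ) :
    Measurable (S.delay x l ν) := by
  have hA : ∀ t, MeasurableSet {ω | S.Alarm x l ω t} := by
    intro t
    obtain ⟨h1, h2, -, -, h5⟩ := S.measurable_traj x t
    have : {ω | S.Alarm x l ω t} = ({ω | (S.traj x ω t).loc = l} ∩
        {ω | (S.traj x ω t).transit = 0}) ∩
        {ω | S.γ l ≤ S.update (S.traj x ω t) (ω ((S.traj x ω t).loc, t))} := by
      ext ω
      simp only [Alarm, SensesAt, mem_ofPred_eq, mem_inter_iff]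
      constructor
      · rintro ⟨⟨rfl, h⟩, h'⟩; exact ⟨⟨rfl, h⟩, h'⟩
      · rintro ⟨⟨rfl, h⟩, h'⟩; exact ⟨⟨rfl, h⟩, h'⟩
    rw [this]
    exact ((h1 l).inter (h2 0)).inter (measurableSet_le measurable_const h5)
  unfold delay alarmTime
  simp only [ENat.toENNReal_iInf]
  exact (Measurable.iInf fun t => measurable_iInf_prop (hA t) _).sub_const _

/-- The remaining sojourn time is a random variable. -/
theorem measurable_remSojourn {s : ℕ} (S : LSCD s) (l : Loc) (w : ℝ) :
    Measurable fun ω => (S.remSojourn l w ω : ℝ≥0∞) := by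
  unfold remSojourn
  split_ifs
  · exact measurable_const
  simp only [ENat.toENNReal_iInf]
  exact Measurable.iInf fun t =>
    measurable_iInf_prop ((S.measurable_traj ⟨l, 0, 0, w⟩ t).1 l).compl _

end LSCD
end UAV

/-! The parts of `C₁` and `C₂` that involve neither the thresholds nor `w` depend only on `f`, `g`,
`τ`, `n`, and the dependence of `C₁` on `w ≥ 0` is bounded. So it suffices to find the terms that
grow with the thresholds: `γ l / D(g_l‖f_l)` for the final passage at `l`, plus the time needed to
end a sojourn at `l'` that is under way when the change occurs.

The delay given the history is controlled by the mean time to alarm from the worst admissible state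
with the change present from slot 0 (`WADD_le`). That mean is bounded by a drift argument
(`meanHit_le_of_drift`), with potentials built from a supersolution `U` of the renewal inequality of
the log-likelihood walk that satisfies `U u ≤ u / D + K` (`exists_renewal_supersolution`). The
second moments enter here: they keep the overshoot correction bounded in `u`.

At `l'` the walk has negative drift, so a sojourn met at level `w` has mean at most `w / D(f‖g) +
O(1)` (`meanHit_exit_le`). At `l` the walk has positive drift. A cycle that falls back to zero may
cost a full absence, of bounded mean `κ`, and the Chernoff coefficient `ρ = E exp(-Z/2) < 1` keeps
the expected total of these costs bounded independently of the threshold (`meanHit_alarm_le`).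

Since `w < γ l'`, the first sojourn at `l'` costs at most `γ l' / D(f‖g) + O(1)`, which `C'`
contains. If the mean remaining sojourn is largest at `w = 0`, an interrupted sojourn costs no more
than a fresh one up to `O(1)`, and the term in `γ l'` disappears. -/

namespace UAV

/-! ### Concave potentials and their tangent inequality -/

/-- A concave function of `t` with slope `(a - t⁺)⁺`. -/
noncomputable def concavePot (a t : ℝ) : ℝ :=
  if t ≤ 0 then a * t else (a ^ 2 - (max (a - t) 0) ^ 2) / 2

/-- Concavity: the graph lies below its tangent at `t`. Integrated over the step of a walk, this
turns the slope into a drift gain. -/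
theorem concavePot_sub_le {a : ℝ} (ha : 0 ≤ a) (t v : ℝ) :
    concavePot a (t - v) ≤ concavePot a t - v * max (a - max t 0) 0 := by
  unfold concavePot
  split_ifs with h1 h2 h2
  · rw [max_eq_right h2, sub_zero, max_eq_left ha]; linarith
  · rw [max_eq_left (not_le.1 h2).le]
    rcases le_total (a - t) 0 with h | h
    · rw [max_eq_right h]; nlinarith
    · rw [max_eq_left h]; nlinarith
  · rw [max_eq_right h2, sub_zero, max_eq_left ha]
    rcases le_total (a - (t - v)) 0 with h | h
    · rw [max_eq_right h]; nlinarith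
    · rw [max_eq_left h]; nlinarith
  · rw [max_eq_left (not_le.1 h2).le]
    rcases le_total (a - (t - v)) 0 with h | h <;> rcases le_total (a - t) 0 with h' | h'
    · rw [max_eq_right h, max_eq_right h']; nlinarith
    · rw [max_eq_right h, max_eq_left h']; nlinarith
    · rw [max_eq_left h, max_eq_right h']; nlinarith
    · rw [max_eq_left h, max_eq_left h']; nlinarith [sq_nonneg v]

theorem concavePot_mono {a : ℝ} (ha : 0 ≤ a) : Monotone (concavePot a) := by
  intro s t h
  have := concavePot_sub_le ha t (t - s)
  rw [sub_sub_cancel] at this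
  have h' : 0 ≤ (t - s) * max (a - max t 0) 0 :=
    mul_nonneg (sub_nonneg.2 h) (le_max_right _ _)
  linarith

theorem concavePot_le {a : ℝ} (ha : 0 ≤ a) (t : ℝ) : concavePot a t ≤ a ^ 2 / 2 := by
  unfold concavePot
  split_ifs with h
  · nlinarith
  · nlinarith [sq_nonneg (max (a - t) 0)]

theorem abs_concavePot_le {a : ℝ} (ha : 0 ≤ a) (t : ℝ) :
    |concavePot a t| ≤ a ^ 2 + a * |t| := by
  rw [abs_le]
  refine ⟨?_, (concavePot_le ha t).trans (by nlinarith [abs_nonneg t, mul_nonneg ha (abs_nonneg t)])⟩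
  have h := concavePot_mono ha (neg_abs_le t)
  have h2 : concavePot a (-|t|) = -(a * |t|) := by
    rw [concavePot, if_pos (by simp)]; ring
  nlinarith [sq_nonneg a]

theorem measurable_concavePot (t : ℝ) : Measurable fun a => concavePot a t := by
  unfold concavePot
  split_ifs
  · fun_prop
  · fun_prop

/-! ### Renewal supersolution for a killed random walk with positive drift -/

section Renewal

variable {Ω : Type*} [MeasurableSpace Ω] {μ : Measure Ω} {X : Ω → ℝ}

theorem exists_integral_posPart_le (hX : Integrable X μ) {ε : ℝ} (hε : 0 < ε) :
    ∃ u, 0 ≤ u ∧ ∫ ω, max (X ω - u) 0 ∂μ ≤ ε := by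
  have h : Filter.Tendsto (fun n : ℕ => ∫ ω, max (X ω - n) 0 ∂μ) Filter.atTop
      (nhds (∫ _, (0 : ℝ) ∂μ)) := by
    refine tendsto_integral_of_dominated_convergence (fun ω => |X ω|) (fun n => ?_) hX.abs ?_ ?_
    · exact (hX.aestronglyMeasurable.sub aestronglyMeasurable_const).sup aestronglyMeasurable_const
    · intro n
      refine Filter.Eventually.of_forall fun ω => ?_
      rw [Real.norm_eq_abs, abs_of_nonneg (le_max_right _ _)]
      have : (0 : ℝ) ≤ n := n.cast_nonneg
      exact max_le (by linarith [le_abs_self (X ω)]) (abs_nonneg _)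
    · refine Filter.Eventually.of_forall fun ω => ?_
      obtain ⟨N, hN⟩ := exists_nat_ge (X ω)
      refine tendsto_const_nhds.congr' ?_
      filter_upwards [Filter.eventually_ge_atTop N] with n hn
      have : (N : ℝ) ≤ n := by exact_mod_cast hn
      rw [max_eq_right (by linarith)]
  rw [integral_zero] at h
  obtain ⟨n, hn⟩ := (h.eventually (ge_mem_nhds hε)).exists
  exact ⟨n, n.cast_nonneg, hn⟩

variable [IsProbabilityMeasure μ]

/-- A supersolution of the renewal inequality of a random walk with positive drift `D` killed
when it exceeds `u`, whose difference from `u / D` is bounded. -/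
theorem exists_renewal_supersolution (hX : Measurable X) (h2 : MemLp X 2 μ) {D ρ : ℝ}
    (hD : ∫ ω, X ω ∂μ = D) (hD0 : 0 < D)
    (he : Integrable (fun ω => Real.exp (-X ω / 2)) μ)
    (hρ : ∫ ω, Real.exp (-X ω / 2) ∂μ = ρ) (hρ1 : ρ < 1) :
    ∃ U : ℝ → ℝ≥0∞, Monotone U ∧ ∃ K, 0 ≤ K ∧
      (∀ u, 0 ≤ u → U u ≤ ENNReal.ofReal (u / D + K)) ∧
      ∀ u, 0 ≤ u → 1 + ∫⁻ ω, (if X ω < u then U (u - X ω) else 0) ∂μ ≤ U u := by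
  have hX1 : Integrable X μ := h2.integrable one_le_two
  -- Beyond `u₀` the mean overshoot is at most `D / 2`, which makes the slope estimate `hslope`
  -- close with `C = 2 / D ^ 2`.
  obtain ⟨u₀, hu₀, hG₀⟩ := exists_integral_posPart_le hX1 (half_pos hD0)
  set A : Ω → ℝ := fun ω => max (X ω - u₀) 0 with hA
  have hA0 : ∀ ω, 0 ≤ A ω := fun ω => le_max_right _ _
  have hAm : Measurable A := (hX.sub_const _).max measurable_const
  have hGi : ∀ u, Integrable (fun ω => max (X ω - u) 0) μ := fun u =>
    (hX1.sub (integrable_const u)).sup (integrable_const 0)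
  have hAi : Integrable A μ := hGi u₀
  have hA2 : Integrable (fun ω => A ω ^ 2) μ := by
    refine h2.integrable_sq.mono' (hAm.pow_const 2).aestronglyMeasurable
      (Filter.Eventually.of_forall fun ω => ?_)
    rw [Real.norm_eq_abs, abs_of_nonneg (sq_nonneg _), ← sq_abs (X ω)]
    exact pow_le_pow_left₀ (hA0 ω)
      (max_le (by linarith [le_abs_self (X ω)]) (abs_nonneg _)) 2
  have hPi : ∀ t, Integrable (fun ω => concavePot (A ω) t) μ := fun t => by
    refine (hA2.add (hAi.mul_const |t|)).mono'
      ((measurable_concavePot t).comp hAm).aestronglyMeasurable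
      (Filter.Eventually.of_forall fun ω => ?_)
    exact abs_concavePot_le (hA0 ω) t
  set G : ℝ → ℝ := fun u => ∫ ω, max (X ω - u) 0 ∂μ with hG
  have hGnn : ∀ u, 0 ≤ G u := fun u => integral_nonneg fun ω => le_max_right _ _
  have hGanti : Antitone G := fun u v h =>
    integral_mono (hGi v) (hGi u) fun ω => max_le_max (by linarith) le_rfl
  -- `r` is concave with slope `G (max u u₀)`; the additive constant makes `r 0 = 0`. It is bounded
  -- because `A` has a second moment.
  set r : ℝ → ℝ := fun u => (∫ ω, concavePot (A ω) (u - u₀) ∂μ) + u₀ * G u₀ with hr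
  have hrneg : ∀ u, u ≤ 0 → r u = u * G u₀ := by
    intro u hu
    have : ∀ ω, concavePot (A ω) (u - u₀) = A ω * (u - u₀) := fun ω => by
      rw [concavePot, if_pos (by linarith)]
    simp only [hr, this]
    rw [integral_mul_const]
    simp only [hG, hA]; ring
  have hrmono : Monotone r := fun u v h =>
    add_le_add (integral_mono (hPi _) (hPi _)
      fun ω => concavePot_mono (hA0 ω) (by linarith)) le_rfl
  have hr0 : ∀ u, 0 ≤ u → 0 ≤ r u := fun u hu => by
    have := hrmono hu
    rwa [hrneg 0 le_rfl, zero_mul] at this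
  set R : ℝ := (∫ ω, A ω ^ 2 / 2 ∂μ) + u₀ * G u₀ with hR
  have hrR : ∀ u, r u ≤ R := fun u => add_le_add (integral_mono (hPi _) (hA2.div_const 2)
    fun ω => concavePot_le (hA0 ω) _) le_rfl
  have hR0 : 0 ≤ R := (hr0 0 le_rfl).trans (hrR 0)
  have hrtan : ∀ u v, r (u - v) ≤ r u - v * G (max u u₀) := by
    intro u v
    have e : ∀ ω, max (A ω - max (u - u₀) 0) 0 = max (X ω - max u u₀) 0 := by
      intro ω
      simp only [hA]
      rcases le_total u u₀ with h | h
      · rw [max_eq_right (sub_nonpos.2 h), max_eq_right h, sub_zero,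
          max_eq_left (le_max_right _ _)]
      · rw [max_eq_left (by linarith : (0 : ℝ) ≤ u - u₀), max_eq_left h]
        rcases le_total (X ω - u₀) 0 with h' | h'
        · rw [max_eq_right h', max_eq_right (by linarith), max_eq_right (by linarith)]
        · rw [max_eq_left h']; congr 1; ring
    have h1 : ∫ ω, concavePot (A ω) (u - v - u₀) ∂μ
        ≤ ∫ ω, (concavePot (A ω) (u - u₀) - v * max (X ω - max u u₀) 0) ∂μ := by
      refine integral_mono (hPi _) ((hPi _).sub ((hGi _).const_mul v)) fun ω => ?_
      have := concavePot_sub_le (hA0 ω) (u - u₀) v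
      rw [e] at this
      have e2 : u - v - u₀ = u - u₀ - v := by ring
      simp only [e2]
      exact this
    rw [integral_sub (hPi _) ((hGi _).const_mul v), integral_const_mul] at h1
    simp only [hr, hG]
    linarith
  set M : ℝ := Real.exp (u₀ / 2) with hM
  -- The correction `b` handles `u ≤ u₀`, where the slope of `r` is frozen at `G u₀` and cannot pay
  -- for the overshoot. There `exp (u / 2)` shrinks on average by the factor `ρ`.
  set b : ℝ → ℝ := fun u => min (Real.exp (u / 2)) M with hb
  have hbmono : Monotone b := fun u v h =>
    min_le_min (Real.exp_le_exp.2 (by linarith)) le_rfl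
  have hb0 : ∀ u, 0 ≤ b u := fun u => le_min (Real.exp_pos _).le (Real.exp_pos _).le
  set C : ℝ := 2 / D ^ 2 with hC
  have hC0 : 0 < C := by positivity
  set B : ℝ := 2 / D * G 0 / (1 - ρ) with hB
  have hB0 : 0 ≤ B := div_nonneg (mul_nonneg (by positivity) (hGnn 0)) (by linarith)
  set V : ℝ → ℝ := fun u => u / D + C * r u + B * b u with hV
  have hVmono : Monotone V := fun u v h => by
    have h1 := hrmono h
    have h2 := hbmono h
    simp only [hV]
    gcongr
  have hV0 : ∀ u, 0 ≤ u → 0 ≤ V u := fun u hu => by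
    have h1 := mul_nonneg hC0.le (hr0 u hu)
    have h2 := mul_nonneg hB0 (hb0 u)
    have h3 := div_nonneg hu hD0.le
    simp only [hV]; linarith
  -- The left side is the slope of `u / D + C * r u` on the negative axis, hence the cost per unit
  -- of overshoot; the right side is the gain from the concavity of `r` per unit of `G`. The
  -- constant `C` is chosen so that gain covers cost.
  have hslope : 1 / D + C * G u₀ ≤ C * D := by
    have h1 : C * G u₀ ≤ C * (D / 2) := mul_le_mul_of_nonneg_left hG₀ hC0.le
    have h2 : C * (D / 2) = 1 / D := by rw [hC]; field_simp
    have h3 : C * D = 1 / D + 1 / D := by rw [hC]; field_simp; norm_num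
    linarith
  have hCD : C * D = 2 / D := by rw [hC]; field_simp
  have hs0 : 0 ≤ 1 / D + C * G u₀ := by have := hGnn u₀; positivity
  refine ⟨fun u => ENNReal.ofReal (V u), fun u v h => ENNReal.ofReal_le_ofReal (hVmono h),
    C * R + B * M, by have := Real.exp_pos (u₀ / 2); positivity, ?_, ?_⟩
  · intro u hu
    refine ENNReal.ofReal_le_ofReal ?_
    have h1 := mul_le_mul_of_nonneg_left (hrR u) hC0.le
    have h2 : B * b u ≤ B * M := mul_le_mul_of_nonneg_left (min_le_right _ _) hB0
    simp only [hV]; linarith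
  · intro u hu
    -- Balance of the overshoot cost against the two gains. For `u ≤ u₀` the geometric decay of `exp
    -- (u / 2)` pays, with `B` chosen so that `B * (1 - ρ) = C * D * G 0`; for `u₀ ≤ u` the constant
    -- majorant `M` suffices and the concavity of `r` pays.
    obtain ⟨β, hβi, hβb, hβE⟩ : ∃ β : Ω → ℝ, Integrable β μ ∧ (∀ ω, b (u - X ω) ≤ β ω) ∧
        B * ∫ ω, β ω ∂μ + (1 / D + C * G u₀) * G u ≤ B * b u + C * D * G (max u u₀) := by
      rcases le_total u u₀ with h | h
      · refine ⟨fun ω => Real.exp (u / 2) * Real.exp (-X ω / 2), he.const_mul _, ?_, ?_⟩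
        · intro ω
          simp only [← Real.exp_add]
          refine (min_le_left _ _).trans (le_of_eq ?_)
          congr 1; ring
        · rw [integral_const_mul, hρ]
          have hbu : b u = Real.exp (u / 2) := min_eq_left (Real.exp_le_exp.2 (by linarith))
          have h1 : (1 : ℝ) ≤ Real.exp (u / 2) := Real.one_le_exp (by linarith)
          have h3 : (1 / D + C * G u₀) * G u ≤ C * D * G 0 :=
            mul_le_mul hslope (hGanti hu) (hGnn _) (by positivity)
          have h4 : B * (1 - ρ) = C * D * G 0 := by
            rw [hB, hCD]; exact div_mul_cancel₀ _ (by linarith)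
          have h5 : B * (1 - ρ) ≤ B * (1 - ρ) * Real.exp (u / 2) :=
            le_mul_of_one_le_right (mul_nonneg hB0 (by linarith)) h1
          have h6 : 0 ≤ C * D * G (max u u₀) := by have := hGnn (max u u₀); positivity
          rw [hbu]
          nlinarith
      · refine ⟨fun _ => M, integrable_const _, fun ω => min_le_right _ _, ?_⟩
        have hbu : b u = M := min_eq_right (Real.exp_le_exp.2 (by linarith))
        rw [hbu, max_eq_left h, integral_const]
        simp only [probReal_univ, one_smul]
        have := mul_le_mul_of_nonneg_right hslope (hGnn u)
        linarith
    -- A majorant of the killed potential that is nonnegative everywhere: past the level `u` the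
    -- last term cancels the negative linear part of `V (u - X ω)`. Killing can thus be traded for
    -- an ordinary integral.
    set Φ : Ω → ℝ := fun ω => (u / D - X ω / D + C * (r u - X ω * G (max u u₀)) + B * β ω)
      + (1 / D + C * G u₀) * max (X ω - u) 0 with hΦ
    have i1 : Integrable (fun ω => u / D - X ω / D) μ :=
      (integrable_const _).sub (hX1.div_const D)
    have i2 : Integrable (fun ω => C * (r u - X ω * G (max u u₀))) μ :=
      ((integrable_const _).sub (hX1.mul_const _)).const_mul C
    have i3 : Integrable (fun ω => B * β ω) μ := hβi.const_mul B
    have i4 : Integrable (fun ω => (1 / D + C * G u₀) * max (X ω - u) 0) μ := (hGi u).const_mul _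
    have i12 : Integrable (fun ω => u / D - X ω / D + C * (r u - X ω * G (max u u₀))) μ := i1.add i2
    have i123 : Integrable
        (fun ω => u / D - X ω / D + C * (r u - X ω * G (max u u₀)) + B * β ω) μ := i12.add i3
    have hΦi : Integrable Φ μ := i123.add i4
    have hkey : ∀ ω, V (u - X ω) ≤ u / D - X ω / D + C * (r u - X ω * G (max u u₀)) + B * β ω := by
      intro ω
      have h1 := mul_le_mul_of_nonneg_left (hrtan u (X ω)) hC0.le
      have h2 := mul_le_mul_of_nonneg_left (hβb ω) hB0
      simp only [hV]
      rw [sub_div]; linarith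
    have hΦ0 : ∀ ω, 0 ≤ Φ ω := by
      intro ω
      have hk := hkey ω
      rcases le_total (X ω) u with h | h
      · have h1 := hV0 _ (sub_nonneg.2 h)
        have h2 : 0 ≤ (1 / D + C * G u₀) * max (X ω - u) 0 := mul_nonneg hs0 (le_max_right _ _)
        simp only [hΦ]; linarith
      · have h1 : V (u - X ω) = (u - X ω) / D + C * ((u - X ω) * G u₀) + B * b (u - X ω) := by
          simp only [hV]; rw [hrneg _ (by linarith)]
        have h2 := mul_nonneg hB0 (hb0 (u - X ω))
        simp only [hΦ]
        rw [max_eq_left (sub_nonneg.2 h)]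
        have h3 : (u - X ω) / D + C * ((u - X ω) * G u₀) + (1 / D + C * G u₀) * (X ω - u) = 0 := by
          ring
        linarith
    have hle : ∀ ω, (if X ω < u then ENNReal.ofReal (V (u - X ω)) else 0)
        ≤ ENNReal.ofReal (Φ ω) := by
      intro ω
      split_ifs with h
      · refine ENNReal.ofReal_le_ofReal ((hkey ω).trans ?_)
        exact le_add_of_nonneg_right (mul_nonneg hs0 (le_max_right _ _))
      · exact zero_le
    have hint : ∫ ω, Φ ω ∂μ ≤ V u - 1 := by
      have : ∫ ω, Φ ω ∂μ = u / D - 1 + C * (r u - D * G (max u u₀)) + B * ∫ ω, β ω ∂μ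
          + (1 / D + C * G u₀) * G u := by
        simp only [hΦ]
        rw [integral_add i123 i4, integral_add i12 i3, integral_add i1 i2,
          integral_sub (integrable_const _) (hX1.div_const D), integral_div, integral_div, hD,
          integral_const_mul, integral_const_mul, integral_const_mul,
          integral_sub (integrable_const _) (hX1.mul_const _), integral_mul_const, hD,
          integral_const, integral_const, div_self hD0.ne']
        simp [hG]
      rw [this]
      simp only [hV]
      linarith
    have hΦI : 0 ≤ ∫ ω, Φ ω ∂μ := integral_nonneg hΦ0
    calc 1 + ∫⁻ ω, (if X ω < u then ENNReal.ofReal (V (u - X ω)) else 0) ∂μ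
        ≤ 1 + ∫⁻ ω, ENNReal.ofReal (Φ ω) ∂μ := by gcongr with ω; exact hle ω
      _ = ENNReal.ofReal 1 + ENNReal.ofReal (∫ ω, Φ ω ∂μ) := by
          rw [ofReal_integral_eq_lintegral_ofReal hΦi (Filter.Eventually.of_forall hΦ0),
            ENNReal.ofReal_one]
      _ = ENNReal.ofReal (1 + ∫ ω, Φ ω ∂μ) := (ENNReal.ofReal_add zero_le_one hΦI).symm
      _ ≤ ENNReal.ofReal (V u) := ENNReal.ofReal_le_ofReal (by linarith)

theorem integrable_exp_neg_half (hX : Measurable X)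
    (he : Integrable (fun ω => Real.exp (-X ω)) μ) :
    Integrable (fun ω => Real.exp (-X ω / 2)) μ := by
  refine (he.add (integrable_const 1)).mono' (hX.neg.div_const 2).exp.aestronglyMeasurable
    (Filter.Eventually.of_forall fun ω => ?_)
  rw [Real.norm_eq_abs, abs_of_pos (Real.exp_pos _)]
  have : Real.exp (-X ω) = Real.exp (-X ω / 2) ^ 2 := by
    rw [← Real.exp_nat_mul]; congr 1; push_cast; ring
  simp only [Pi.add_apply, this]
  nlinarith [sq_nonneg (Real.exp (-X ω / 2) - 1)]

/-- The integral of `(exp (-X / 2) - 1) ^ 2` equals `2 - 2 * E exp (-X / 2)`. It is nonnegative, and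
it vanishes only if `X = 0` almost everywhere, which the nonzero mean excludes. -/
theorem integral_exp_neg_half_lt_one (hX : Measurable X)
    (he : Integrable (fun ω => Real.exp (-X ω)) μ) (h1 : ∫ ω, Real.exp (-X ω) ∂μ = 1)
    (hne : ∫ ω, X ω ∂μ ≠ 0) : ∫ ω, Real.exp (-X ω / 2) ∂μ < 1 := by
  have hi := integrable_exp_neg_half hX he
  have hsq : ∀ ω, (Real.exp (-X ω / 2) - 1) ^ 2
      = Real.exp (-X ω) - 2 * Real.exp (-X ω / 2) + 1 := fun ω => by
    have : Real.exp (-X ω) = Real.exp (-X ω / 2) ^ 2 := by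
      rw [← Real.exp_nat_mul]; congr 1; push_cast; ring
    rw [this]; ring
  have hi2 : Integrable (fun ω => Real.exp (-X ω) - 2 * Real.exp (-X ω / 2)) μ :=
    he.sub (hi.const_mul 2)
  have hii : Integrable (fun ω => (Real.exp (-X ω / 2) - 1) ^ 2) μ := by
    simp only [hsq]
    exact hi2.add (integrable_const 1)
  have hval : ∫ ω, (Real.exp (-X ω / 2) - 1) ^ 2 ∂μ = 2 - 2 * ∫ ω, Real.exp (-X ω / 2) ∂μ := by
    simp only [hsq]
    rw [integral_add hi2 (integrable_const 1),
      integral_sub he (hi.const_mul 2), integral_const_mul, h1, integral_const]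
    simp only [probReal_univ, one_smul]; ring
  have hnn : 0 ≤ ∫ ω, (Real.exp (-X ω / 2) - 1) ^ 2 ∂μ := integral_nonneg fun ω => sq_nonneg _
  refine lt_of_le_of_ne (by linarith) fun h => hne ?_
  rw [h] at hval
  have h0 := (integral_eq_zero_iff_of_nonneg (fun ω => sq_nonneg _) hii).1 (by rw [hval]; norm_num)
  refine integral_eq_zero_of_ae ?_
  filter_upwards [h0] with ω hω
  have h3 : Real.exp (-X ω / 2) = 1 := by
    have : (Real.exp (-X ω / 2) - 1) ^ 2 = 0 := hω
    have := pow_eq_zero_iff (two_ne_zero) |>.1 this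
    linarith
  have h4 := Real.exp_eq_one_iff _ |>.1 h3
  show X ω = 0
  linarith

end Renewal

end UAV

/-! ### The log-likelihood walk under both laws -/

namespace UAV

section LogLikelihood

variable {α : Type*} [MeasurableSpace α] {f g : Measure α} [IsProbabilityMeasure f]
  [IsProbabilityMeasure g]

theorem integral_llr_eq (hfg : f ≪ g) : ∫ y, llr f g y ∂f = (InformationTheory.klDiv f g).toReal :=
  (InformationTheory.toReal_klDiv_of_measure_eq hfg (by simp)).symm

theorem klDiv_toReal_pos (hfg : f ≪ g) (hi : Integrable (llr f g) f) (hne : f ≠ g) :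
    0 < (InformationTheory.klDiv f g).toReal :=
  ENNReal.toReal_pos (fun h => hne (InformationTheory.klDiv_eq_zero_iff.1 h))
    (InformationTheory.klDiv_ne_top hfg hi)

theorem integrable_exp_neg_llr (hgf : g ≪ f) :
    Integrable (fun y => Real.exp (-llr g f y)) g :=
  Measure.integrable_toReal_rnDeriv.congr (exp_neg_llr hgf).symm

theorem integral_exp_neg_llr (hfg : f ≪ g) (hgf : g ≪ f) :
    ∫ y, Real.exp (-llr g f y) ∂g = 1 := by
  rw [integral_congr_ae (exp_neg_llr hgf), Measure.integral_toReal_rnDeriv hfg]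
  simp

/-- Under the post-change law: the drift function of the first passage of the log-likelihood
walk above a level, and the Chernoff coefficient. -/
theorem exists_llr_supersolution (hfg : f ≪ g) (hgf : g ≪ f) (hne : f ≠ g)
    (h2 : MemLp (llr g f) 2 g) :
    (∃ U : ℝ → ℝ≥0∞, Monotone U ∧ ∃ K, 0 ≤ K ∧
      (∀ u, 0 ≤ u → U u ≤ ENNReal.ofReal (u / (InformationTheory.klDiv g f).toReal + K)) ∧
      ∀ u, 0 ≤ u → 1 + ∫⁻ y, (if llr g f y < u then U (u - llr g f y) else 0) ∂g ≤ U u) ∧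
    ∃ ρ : ℝ, 0 ≤ ρ ∧ ρ < 1 ∧
      ∫⁻ y, ENNReal.ofReal (Real.exp (-llr g f y / 2)) ∂g = ENNReal.ofReal ρ := by
  have hm := measurable_llr g f
  have h0 := klDiv_toReal_pos hgf (h2.integrable one_le_two) hne.symm
  have hD := integral_llr_eq hgf
  have he := integrable_exp_neg_llr hgf
  have hi := integrable_exp_neg_half hm he
  have hlt := integral_exp_neg_half_lt_one hm he (integral_exp_neg_llr hfg hgf) (hD ▸ h0.ne')
  exact ⟨exists_renewal_supersolution hm h2 hD h0 hi rfl hlt,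
    _, integral_nonneg fun y => (Real.exp_pos _).le, hlt,
    (ofReal_integral_eq_lintegral_ofReal hi
      (Filter.Eventually.of_forall fun y => (Real.exp_pos _).le)).symm⟩

/-- Under the pre-change law: the drift function of the first return of the log-likelihood walk
to zero. -/
theorem exists_neg_llr_supersolution (hfg : f ≪ g) (hgf : g ≪ f) (hne : f ≠ g)
    (h2 : MemLp (llr g f) 2 f) :
    ∃ U : ℝ → ℝ≥0∞, Monotone U ∧ ∃ K, 0 ≤ K ∧
      (∀ u, 0 ≤ u → U u ≤ ENNReal.ofReal (u / (InformationTheory.klDiv f g).toReal + K)) ∧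
      ∀ u, 0 ≤ u → 1 + ∫⁻ y, (if 0 < u + llr g f y then U (u + llr g f y) else 0) ∂f ≤ U u := by
  have hn := neg_llr hfg
  have h2' : MemLp (llr f g) 2 f := h2.neg.ae_eq (by
    filter_upwards [hn] with y hy
    simp only [Pi.neg_apply] at hy ⊢
    linarith)
  -- With `f` and `g` exchanged, return to zero of the walk with steps `llr g f` under `f` becomes
  -- passage above a level of the walk with steps `llr f g = -llr g f`.
  obtain ⟨⟨U, hU, K, hK, h1, h3⟩, -⟩ := exists_llr_supersolution hgf hfg hne.symm h2'
  refine ⟨U, hU, K, hK, h1, fun u hu => (le_of_eq ?_).trans (h3 u hu)⟩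
  congr 1
  refine lintegral_congr_ae ?_
  filter_upwards [hn] with y hy
  have e : llr g f y = -llr f g y := by rw [← hy, Pi.neg_apply]
  rw [e, ← sub_eq_add_neg]
  simp only [sub_pos]

end LogLikelihood

/-! ### Splitting off the first time slot -/

/-- The path that shows the measurements `p.1` in slot `0` and continues with `p.2`. -/
def consPath {s : ℕ} (p : (Loc → Meas s) × Path s) : Path s
  | (l, 0) => p.1 l
  | (l, t + 1) => p.2 (l, t)

theorem measurable_consPath {s : ℕ} : Measurable (consPath (s := s)) := by
  refine measurable_pi_lambda _ ?_
  rintro ⟨l, _ | t⟩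
  · exact (measurable_pi_apply l).comp measurable_fst
  · exact (measurable_pi_apply (l, t)).comp measurable_snd

/-- An independent sequence consists of its first slot and an independent sequence. -/
theorem infinitePi_eq_map_consPath {s : ℕ} (μ : Loc × ℕ → Measure (Meas s))
    [∀ p, IsProbabilityMeasure (μ p)] :
    Measure.infinitePi μ = ((Measure.infinitePi fun l => μ (l, 0)).prod
      (Measure.infinitePi fun p : Loc × ℕ => μ (p.1, p.2 + 1))).map consPath := by
  classical
  symm
  refine Measure.eq_infinitePi _ fun I t ht => ?_
  let e₀ : Loc → Loc × ℕ := fun l => (l, 0)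
  let e₁ : Loc × ℕ → Loc × ℕ := fun p => (p.1, p.2 + 1)
  have h₀ : Function.Injective e₀ := fun a b h => congrArg Prod.fst h
  have h₁ : Function.Injective e₁ := by
    rintro ⟨a, i⟩ ⟨b, j⟩ h
    simp only [e₁, Prod.mk.injEq, add_left_inj] at h
    rw [h.1, h.2]
  have hpre : consPath ⁻¹' (Set.pi I t)
      = (Set.pi (I.preimage e₀ h₀.injOn) fun l => t (e₀ l)) ×ˢ
        (Set.pi (I.preimage e₁ h₁.injOn) fun p => t (e₁ p)) := by
    ext ⟨y, ω⟩
    simp only [mem_preimage, Set.mem_pi, mem_prod, Finset.mem_coe, Finset.mem_preimage]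
    constructor
    · exact fun h => ⟨fun l hl => h _ hl, fun p hp => h _ hp⟩
    · rintro ⟨h, h'⟩ ⟨l, _ | i⟩ hi
      · exact h l hi
      · exact h' (l, i) hi
  rw [Measure.map_apply measurable_consPath
    (MeasurableSet.pi I.countable_toSet fun p _ => ht p), hpre, Measure.prod_prod,
    Measure.infinitePi_pi _ (fun l _ => ht _), Measure.infinitePi_pi _ (fun p _ => ht _)]
  have p₀ := Finset.prod_preimage' e₀ I h₀.injOn fun p => μ p (t p)
  have p₁ := Finset.prod_preimage' e₁ I h₁.injOn fun p => μ p (t p)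
  -- Slot-zero coordinates form the range of `e₀`, and the remaining ones are exactly the range of
  -- `e₁`, so the finite product factors accordingly.
  rw [← Finset.prod_filter_mul_prod_filter_not I (· ∈ range e₀)]
  refine congrArg₂ (· * ·) p₀ (p₁.trans (Finset.prod_congr ?_ fun _ _ => rfl))
  refine Finset.filter_congr ?_
  rintro ⟨l, _ | i⟩ -
  · simp [e₀, e₁]
  · simp [e₀, e₁]

theorem lintegral_infinitePi_cons {s : ℕ} (μ : Loc × ℕ → Measure (Meas s))
    [∀ p, IsProbabilityMeasure (μ p)] {F : Path s → ℝ≥0∞} (hF : Measurable F) :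
    ∫⁻ ω, F ω ∂Measure.infinitePi μ
      = ∫⁻ y, ∫⁻ ω, F (consPath (y, ω)) ∂Measure.infinitePi (fun p : Loc × ℕ => μ (p.1, p.2 + 1))
        ∂Measure.infinitePi fun l => μ (l, 0) := by
  rw [infinitePi_eq_map_consPath μ, lintegral_map hF measurable_consPath]
  exact lintegral_prod (fun p => F (consPath p)) (hF.comp measurable_consPath).aemeasurable

/-- An integral over one slot that involves the measurement at `l` only. -/
theorem lintegral_slot_eval {s : ℕ} (π : Loc → Measure (Meas s)) [∀ l, IsProbabilityMeasure (π l)]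
    (l : Loc) {F : Meas s → ℝ≥0∞} (hF : Measurable F) :
    ∫⁻ y, F (y l) ∂Measure.infinitePi π = ∫⁻ z, F z ∂π l := by
  rw [← Measure.infinitePi_map_eval π l, lintegral_map hF (measurable_pi_apply l)]

end UAV

/-! ### Hitting times and the drift criterion -/

namespace UAV
namespace LSCD

variable {s : ℕ} (S : LSCD s)

theorem traj_consPath (x : State) (y : Loc → Meas s) (ω : Path s) (t : ℕ) :
    S.traj x (consPath (y, ω)) (t + 1) = S.traj (S.step x y) ω t := by
  induction t with
  | zero => rfl
  | succ t ih => rw [traj, ih]; rfl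

/-- The first time at which the event `E` (about the state and the measurements of a slot) has
occurred. -/
noncomputable def hitTime (E : State → (Loc → Meas s) → Prop) (x : State) (ω : Path s) : ℕ∞ :=
  ⨅ (t : ℕ) (_ : E (S.traj x ω t) (fun l => ω (l, t))), ((t + 1 : ℕ) : ℕ∞)

variable (E : State → (Loc → Meas s) → Prop)

open Classical in
theorem hitTime_consPath (x : State) (y : Loc → Meas s) (ω : Path s) :
    S.hitTime E x (consPath (y, ω)) = if E x y then 1 else 1 + S.hitTime E (S.step x y) ω := by
  have h : S.hitTime E x (consPath (y, ω)) = (⨅ (_ : E x y), (1 : ℕ∞)) ⊓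
      ⨅ (t : ℕ) (_ : E (S.traj (S.step x y) ω t) (fun l => ω (l, t))),
        ((t + 1 + 1 : ℕ) : ℕ∞) := by
    rw [hitTime, ← inf_iInf_nat_succ]
    congr 1
    refine iInf_congr fun t => ?_
    rw [traj_consPath]; rfl
  rw [h]
  split_ifs with hE
  · rw [iInf_pos hE]
    refine inf_eq_left.2 (le_iInf fun t => le_iInf fun _ => ?_)
    exact_mod_cast Nat.le_add_left 1 (t + 1)
  · rw [iInf_neg hE, top_inf_eq, hitTime, ENat.add_iInf]
    refine iInf_congr fun t => ?_
    by_cases hp : E (S.traj (S.step x y) ω t) (fun l => ω (l, t))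
    · rw [iInf_pos hp, iInf_pos hp]; push_cast; ring
    · rw [iInf_neg hp, iInf_neg hp]; simp

/-- Law of the measurements that are distributed as `π l` at `l` in all slots. -/
noncomputable abbrev law (π : Loc → Measure (Meas s)) : Measure (Path s) :=
  Measure.infinitePi fun p : Loc × ℕ => π p.1

/-- Law of the measurements of one slot. -/
noncomputable abbrev slotLaw (π : Loc → Measure (Meas s)) : Measure (Loc → Meas s) :=
  Measure.infinitePi π

/-- The mean of the hitting time truncated at `N`. -/
noncomputable def truncMean (π : Loc → Measure (Meas s)) (N : ℕ) (x : State) : ℝ≥0∞ :=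
  ∫⁻ ω, min (S.hitTime E x ω : ℝ≥0∞) N ∂law π

/-- The mean of the hitting time. -/
noncomputable def meanHit (π : Loc → Measure (Meas s)) (x : State) : ℝ≥0∞ :=
  ∫⁻ ω, (S.hitTime E x ω : ℝ≥0∞) ∂law π

variable {E} (π : Loc → Measure (Meas s))

/-- Truncation makes induction on the horizon possible, since a mean hitting time may be infinite a
priori; monotone convergence recovers the full mean. -/
theorem meanHit_eq_iSup (hE : ∀ x, Measurable fun ω => (S.hitTime E x ω : ℝ≥0∞)) (x : State) :
    S.meanHit E π x = ⨆ N, S.truncMean E π N x := by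
  simp only [meanHit, truncMean]
  rw [← lintegral_iSup (fun N => (hE x).min measurable_const)
    (fun M N h ω => min_le_min le_rfl (by exact_mod_cast h))]
  refine lintegral_congr fun ω => ?_
  rw [← inf_iSup_eq (f := fun N : ℕ => (N : ℝ≥0∞)), ENNReal.iSup_natCast, inf_top_eq]

variable [∀ l, IsProbabilityMeasure (π l)]

open Classical in
theorem lintegral_min_hitTime_consPath (N : ℕ) (x : State) (y : Loc → Meas s) :
    ∫⁻ ω, min (S.hitTime E x (consPath (y, ω)) : ℝ≥0∞) (N + 1 : ℕ) ∂law π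
      = if E x y then 1 else 1 + S.truncMean E π N (S.step x y) := by
  simp only [hitTime_consPath]
  split_ifs with h
  · have : min (((1 : ℕ∞) : ℝ≥0∞)) ((N + 1 : ℕ) : ℝ≥0∞) = 1 := by
      rw [ENat.toENNReal_one]
      exact min_eq_left (by exact_mod_cast Nat.le_add_left 1 N)
    simp only [this, lintegral_const, measure_univ, mul_one]
  · have : ∀ ω, min (((1 + S.hitTime E (S.step x y) ω : ℕ∞) : ℝ≥0∞)) ((N + 1 : ℕ) : ℝ≥0∞)
        = 1 + min (S.hitTime E (S.step x y) ω : ℝ≥0∞) N := by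
      intro ω
      rw [ENat.toENNReal_add, ENat.toENNReal_one, Nat.cast_add, Nat.cast_one, add_comm (N : ℝ≥0∞),
        min_add_add_left]
    simp only [this]
    rw [lintegral_add_left measurable_const, lintegral_const, measure_univ, mul_one, truncMean]

open Classical in
theorem truncMean_succ (hE : ∀ x, Measurable fun ω => (S.hitTime E x ω : ℝ≥0∞))
    (N : ℕ) (x : State) :
    S.truncMean E π (N + 1) x
      = ∫⁻ y, (if E x y then 1 else 1 + S.truncMean E π N (S.step x y)) ∂slotLaw π := by
  rw [truncMean, lintegral_infinitePi_cons _ ((hE x).min measurable_const)]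
  exact lintegral_congr fun y => S.lintegral_min_hitTime_consPath π N x y

open Classical in
theorem measurable_truncMean_step (hE : ∀ x, Measurable fun ω => (S.hitTime E x ω : ℝ≥0∞))
    (N : ℕ) (x : State) :
    Measurable fun y => if E x y then 1 else 1 + S.truncMean E π N (S.step x y) := by
  have h : Measurable fun p : (Loc → Meas s) × Path s =>
      min (S.hitTime E x (consPath p) : ℝ≥0∞) (N + 1 : ℕ) :=
    ((hE x).comp measurable_consPath).min measurable_const
  have h2 := h.lintegral_prod_right' (ν := law π)
  simpa only [S.lintegral_min_hitTime_consPath π N x] using h2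

open Classical in
theorem meanHit_eq (hE : ∀ x, Measurable fun ω => (S.hitTime E x ω : ℝ≥0∞))
    (x : State) :
    S.meanHit E π x
      = ∫⁻ y, (if E x y then 1 else 1 + S.meanHit E π (S.step x y)) ∂slotLaw π := by
  rw [meanHit, lintegral_infinitePi_cons _ (hE x)]
  refine lintegral_congr fun y => ?_
  simp only [hitTime_consPath]
  split_ifs with h
  · simp
  · simp only [ENat.toENNReal_add, ENat.toENNReal_one]
    rw [lintegral_add_left measurable_const, lintegral_const, measure_univ, mul_one, meanHit]

open Classical in
/-- Drift criterion: a nonnegative function that decreases by `1` on average in each slot until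
`E` occurs bounds the mean hitting time of `E`. -/
theorem meanHit_le_of_drift (hE : ∀ x, Measurable fun ω => (S.hitTime E x ω : ℝ≥0∞))
    {G : State → Prop} (hG : ∀ x y, G x → G (S.step x y))
    {V : State → ℝ≥0∞}
    (hV : ∀ x, G x → 1 + ∫⁻ y, (if E x y then 0 else V (S.step x y)) ∂slotLaw π ≤ V x)
    {x : State} (hx : G x) : S.meanHit E π x ≤ V x := by
  rw [S.meanHit_eq_iSup π hE]
  refine iSup_le fun N => ?_
  induction N generalizing x with
  | zero => simp [truncMean]
  | succ N ih =>
    rw [S.truncMean_succ π hE]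
    refine le_trans ?_ (hV x hx)
    calc ∫⁻ y, (if E x y then 1 else 1 + S.truncMean E π N (S.step x y)) ∂slotLaw π
        ≤ ∫⁻ y, (1 + if E x y then 0 else V (S.step x y)) ∂slotLaw π := by
          refine lintegral_mono fun y => ?_
          split_ifs
          · simp
          · exact add_le_add le_rfl (ih (hG x y hx))
      _ = _ := by
          rw [lintegral_add_left measurable_const, lintegral_const, measure_univ, mul_one]

end LSCD
end UAV

/-! ### Reduction of the worst-case delay to the worst starting state -/

namespace UAV
namespace LSCD

variable {s : ℕ} (S : LSCD s)

/-- In a slot that begins in state `x` a change at `l` is declared. -/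
def AlarmEvent (l : Loc) (x : State) (y : Loc → Meas s) : Prop :=
  SensesAt x l ∧ S.γ l ≤ S.update x (y l)

/-- At the end of the slot the UAV is not at `l` any more. -/
def ExitEvent (l : Loc) (x : State) (y : Loc → Meas s) : Prop := (S.step x y).loc ≠ l

theorem alarmTime_eq_hitTime (x : State) (l : Loc) (ω : Path s) :
    S.alarmTime x l ω = S.hitTime (S.AlarmEvent l) x ω := rfl

theorem measurable_hitTime_alarm (l : Loc) (x : State) :
    Measurable fun ω => (S.hitTime (S.AlarmEvent l) x ω : ℝ≥0∞) := by
  have h := S.measurable_delay x l 0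
  unfold delay at h
  simpa [alarmTime_eq_hitTime] using h

theorem measurable_hitTime_exit (l : Loc) (x : State) :
    Measurable fun ω => (S.hitTime (S.ExitEvent l) x ω : ℝ≥0∞) := by
  unfold hitTime
  simp only [ENat.toENNReal_iInf]
  exact Measurable.iInf fun t =>
    measurable_iInf_prop ((S.measurable_traj x (t + 1)).1 l).compl _

theorem remSojourn_eq_hitTime {l : Loc} {w : ℝ} (hw : w < S.γ l) (ω : Path s) :
    S.remSojourn l w ω = S.hitTime (S.ExitEvent l) ⟨l, 0, 0, w⟩ ω := by
  rw [remSojourn, if_neg (not_le.2 hw), ← inf_iInf_nat_succ, iInf_neg (by simp [traj]), top_inf_eq]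
  rfl

theorem meanRemSojourn_eq_meanHit {l : Loc} {w : ℝ} (hw : w < S.γ l) :
    S.meanRemSojourn l w = S.meanHit (S.ExitEvent l) S.f ⟨l, 0, 0, w⟩ := by
  unfold meanRemSojourn meanHit
  simp only [S.remSojourn_eq_hitTime hw]
  rfl

instance {l : Loc} {ν : ℕ} [∀ l, IsProbabilityMeasure (S.f l)] [∀ l, IsProbabilityMeasure (S.g l)]
    (p : Loc × ℕ) : IsProbabilityMeasure (if p.1 = l ∧ ν ≤ p.2 then S.g l else S.f p.1) := by
  split_ifs <;> infer_instance

instance [∀ l, IsProbabilityMeasure (S.f l)] [∀ l, IsProbabilityMeasure (S.g l)] (l k : Loc) :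
    IsProbabilityMeasure (if k = l then S.g l else S.f k) := by
  split_ifs <;> infer_instance

theorem lawChange_zero (l : Loc) :
    S.lawChange l 0 = law fun k => if k = l then S.g l else S.f k := by
  simp [lawChange, law]

-- Only an inequality: an alarm in the first slot makes the delay zero, while the shifted path goes
-- on and may have a positive delay.
open Classical in
theorem delay_consPath_le (x : State) (l : Loc) (ν : ℕ) (y : Loc → Meas s) (ω : Path s) :
    S.delay x l (ν + 1) (consPath (y, ω)) ≤ S.delay (S.step x y) l ν ω := by
  unfold delay
  rw [alarmTime_eq_hitTime, hitTime_consPath, alarmTime_eq_hitTime]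
  split_ifs
  · rw [ENat.toENNReal_one, tsub_eq_zero_of_le (by exact_mod_cast Nat.le_add_left 1 ν)]
    exact zero_le
  · rw [ENat.toENNReal_add, ENat.toENNReal_one, Nat.cast_add, Nat.cast_one, add_comm (ν : ℝ≥0∞),
      ENNReal.add_sub_add_eq_sub_left ENNReal.one_ne_top]

/-- The event `A` is determined by the measurements before slot `ν`. -/
def DeterminedBefore (ν : ℕ) (A : Set (Path s)) : Prop :=
  ∀ ω ω' : Path s, (∀ l t, t < ν → ω (l, t) = ω' (l, t)) → (ω ∈ A ↔ ω' ∈ A)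

theorem traj_congr (x : State) {ν : ℕ} {ω ω' : Path s}
    (h : ∀ l t, t < ν → ω (l, t) = ω' (l, t)) {t : ℕ} (ht : t ≤ ν) :
    S.traj x ω t = S.traj x ω' t := by
  induction t with
  | zero => rfl
  | succ t ih =>
    rw [traj, traj, ih (by omega)]
    congr 1
    funext l
    exact h l t (by omega)

theorem determinedBefore_of_history (x : State) (l : Loc) (ν : ℕ) {A : Set (Path s)}
    (hA : MeasurableSet[S.history x l ν] A) : DeterminedBefore ν A := by
  induction A, hA using MeasurableSpace.generateFrom_induction with
  | hC E hE _ =>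
    obtain ⟨t, ht, B, -, rfl⟩ := hE
    intro ω ω' h
    simp only [mem_ofPred_eq, S.traj_congr x h ht.le, h l t ht]
  | empty => intro ω ω' _; simp
  | compl E _ ih => intro ω ω' h; simp only [mem_compl_iff, ih ω ω' h]
  | iUnion E _ ih => intro ω ω' h; simp only [mem_iUnion, ih _ ω ω' h]

variable [∀ l, IsProbabilityMeasure (S.f l)] [∀ l, IsProbabilityMeasure (S.g l)]

instance (l : Loc) (ν : ℕ) : IsProbabilityMeasure (S.lawChange l ν) := by
  unfold lawChange; infer_instance

theorem lintegral_lawChange_succ (l : Loc) (ν : ℕ) {F : Path s → ℝ≥0∞} (hF : Measurable F) :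
    ∫⁻ ω, F ω ∂S.lawChange l (ν + 1)
      = ∫⁻ y, ∫⁻ ω, F (consPath (y, ω)) ∂S.lawChange l ν ∂slotLaw S.f := by
  rw [lawChange, lintegral_infinitePi_cons _ hF]
  simp [lawChange, slotLaw]

/-- Induction on the change time: averaging over the first slot leaves the same problem with change
time `ν`, the next state and a slice of `A`. At change time 0, an event determined by no measurement
is empty or everything. The bound holds for every event of the past, not only for what was seen at
`l`. -/
theorem setLIntegral_delay_le {G : State → Prop} (hG : ∀ x y, G x → G (S.step x y)) {l : Loc}
    {c : ℝ≥0∞}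
    (hc : ∀ x, G x → ∫⁻ ω, (S.alarmTime x l ω : ℝ≥0∞) ∂S.lawChange l 0 ≤ c) {x : State}
    (hx : G x) (ν : ℕ) {A : Set (Path s)} (hAm : MeasurableSet A) (hA : DeterminedBefore ν A) :
    ∫⁻ ω in A, S.delay x l ν ω ∂S.lawChange l ν ≤ c * S.lawChange l ν A := by
  induction ν generalizing x A with
  | zero =>
    rcases A.eq_empty_or_nonempty with rfl | ⟨ω₀, h₀⟩
    · simp
    · have : A = univ := eq_univ_of_forall fun ω => (hA ω₀ ω (by simp)).1 h₀
      rw [this, Measure.restrict_univ, measure_univ, mul_one]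
      simpa [delay] using hc x hx
  | succ ν ih =>
    rw [← lintegral_indicator hAm, ← lintegral_indicator_one hAm,
      S.lintegral_lawChange_succ l ν ((S.measurable_delay x l _).indicator hAm),
      S.lintegral_lawChange_succ l ν (measurable_one.indicator hAm)]
    have hm : Measurable fun y => ∫⁻ ω, A.indicator 1 (consPath (y, ω)) ∂S.lawChange l ν :=
      ((measurable_one.indicator hAm).comp measurable_consPath).lintegral_prod_right'
        (f := fun p => A.indicator (1 : Path s → ℝ≥0∞) (consPath p))
    rw [← lintegral_const_mul c hm]
    refine lintegral_mono fun y => ?_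
    have hc1 : Measurable fun ω : Path s => consPath (y, ω) :=
      measurable_consPath.comp measurable_prodMk_left
    have hAy : MeasurableSet ((fun ω : Path s => consPath (y, ω)) ⁻¹' A) := hc1 hAm
    have hdet : DeterminedBefore ν ((fun ω : Path s => consPath (y, ω)) ⁻¹' A) := by
      intro ω ω' h
      refine hA _ _ ?_
      rintro k (_ | t) ht
      · rfl
      · exact h k t (by omega)
    have := ih (hG x y hx) hAy hdet
    rw [← lintegral_indicator hAy, ← lintegral_indicator_one hAy] at this
    refine le_trans (lintegral_mono fun ω => ?_) this
    by_cases hω : consPath (y, ω) ∈ A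
    · rw [indicator_of_mem hω, indicator_of_mem (by exact hω)]
      exact S.delay_consPath_le x l ν y ω
    · rw [indicator_of_notMem hω]; exact zero_le

/-- The worst-case average delay is at most the mean time to alarm from the worst state. -/
theorem WADD_le {G : State → Prop} (hG : ∀ x y, G x → G (S.step x y)) {l : Loc} {c : ℝ≥0∞}
    (hc : ∀ x, G x → ∫⁻ ω, (S.alarmTime x l ω : ℝ≥0∞) ∂S.lawChange l 0 ≤ c) {x : State}
    (hx : G x) : S.WADD x l ≤ c := by
  refine iSup_le fun ν => essSup_le_of_ae_le _ ?_
  have hm := S.history_le x l ν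
  -- An almost sure bound on the conditional mean follows from bounds on its integrals over history
  -- events.
  refine ae_of_ae_trim hm (ae_le_of_forall_setLIntegral_le_of_sigmaFinite
    (measurable_condLExp _ _ _) fun A hA _ => ?_)
  rw [setLIntegral_condLExp_trim hm _ _ hA, setLIntegral_const, trim_measurableSet_eq hm hA]
  exact S.setLIntegral_delay_le hG hc hx ν (hm A hA) (S.determinedBefore_of_history x l ν hA)

end LSCD
end UAV

/-! ### Reachable states and the transition rule -/

namespace UAV

theorem Loc.other_ne (l : Loc) : l.other ≠ l := by cases l <;> simp [Loc.other]

theorem Loc.other_other (l : Loc) : l.other.other = l := by cases l <;> rfl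

theorem Loc.eq_other_of_ne {l k : Loc} (h : k ≠ l) : k = l.other := by
  cases l <;> cases k <;> simp_all [Loc.other]

namespace LSCD

variable {s : ℕ} (S : LSCD s)

/-- States that the UAV can reach. -/
structure Admissible (x : State) : Prop where
  stat_nonneg : 0 ≤ x.stat
  stat_lt : x.stat < S.γ x.loc
  transit_le : x.transit ≤ S.τ
  stat_eq : x.transit ≠ 0 → x.stat = 0

variable {S}

theorem Admissible.fresh (hγ : ∀ l, 0 < S.γ l) (l : Loc) : S.Admissible (State.fresh l) :=
  ⟨le_rfl, hγ l, Nat.zero_le _, fun _ => rfl⟩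

theorem Admissible.depart (hγ : ∀ l, 0 < S.γ l) (x : State) : S.Admissible (S.depart x) :=
  ⟨le_rfl, hγ _, le_rfl, fun _ => rfl⟩

theorem Admissible.step (hγ : ∀ l, 0 < S.γ l) {x : State} (hx : S.Admissible x)
    (y : Loc → Meas s) : S.Admissible (S.step x y) := by
  unfold LSCD.step
  split_ifs with h1 h2 h3 h4
  · exact ⟨hx.stat_nonneg, hx.stat_lt, (Nat.sub_le _ _).trans hx.transit_le,
      fun _ => hx.stat_eq h1⟩
  · exact Admissible.depart hγ x
  · exact Admissible.depart hγ x
  · exact ⟨le_rfl, hγ _, hx.transit_le, fun _ => rfl⟩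
  · exact ⟨le_max_right _ _, not_le.1 h2, hx.transit_le, fun h => absurd h h1⟩

theorem Admissible.arrival (hγ : ∀ l, 0 < S.γ l) (l : Loc) : S.Admissible ⟨l, S.τ, 0, 0⟩ :=
  ⟨le_rfl, hγ _, le_rfl, fun _ => rfl⟩

theorem measurable_Z (l : Loc) : Measurable (S.Z l) := measurable_llr _ _

theorem step_transit {x : State} (h : x.transit ≠ 0) (y : Loc → Meas s) :
    S.step x y = { x with transit := x.transit - 1 } := by rw [step, if_pos h]

theorem step_congr {x : State} {y y' : Loc → Meas s} (h : y x.loc = y' x.loc) :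
    S.step x y = S.step x y' := by rw [step, step, h]

theorem step_eq_depart {x : State} {y : Loc → Meas s} (h : (S.step x y).loc ≠ x.loc) :
    S.step x y = S.depart x := by
  unfold step at h ⊢
  split_ifs with h1 h2 h3 h4
  · simp [h1] at h
  · rfl
  · rfl
  · simp [h1, h2, h3, h4] at h
  · simp [h1, h2, h3] at h

open Classical in
theorem step_sensing (l : Loc) (c : ℕ) (w : ℝ) (y : Loc → Meas s) :
    S.step ⟨l, 0, c, w⟩ y = if S.γ l ≤ max (w + S.Z l (y l)) 0 then ⟨l.other, S.τ, 0, 0⟩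
      else if max (w + S.Z l (y l)) 0 ≤ 0 then
        if S.n l ≤ c + 1 then ⟨l.other, S.τ, 0, 0⟩ else ⟨l, 0, c + 1, 0⟩
      else ⟨l, 0, c, max (w + S.Z l (y l)) 0⟩ := by
  rw [step, if_neg (by simp)]
  rfl

/-! ### Mean length of a sojourn -/

section Sojourn

variable {l : Loc} {π : Loc → Measure (Meas s)} [∀ l, IsProbabilityMeasure (π l)]

/-- The mean remaining sojourn time is bounded by the drift function of one SPRT cycle. -/
theorem meanHit_exit_le (hγ : ∀ l, 0 < S.γ l) {U : ℝ → ℝ≥0∞} (hU : Monotone U)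
    (hdrift : ∀ u, 0 ≤ u → 1 + ∫⁻ z, (if 0 < u + S.Z l z then U (u + S.Z l z) else 0) ∂π l ≤ U u)
    {x : State} (hx : S.Admissible x) (hl : x.loc = l) :
    S.meanHit (S.ExitEvent l) π x
      ≤ x.transit + (U x.stat + ((S.n l - x.cycles : ℕ) : ℝ≥0∞) * U 0) := by
  classical
  -- The potential adds the travel slots left, the current cycle and one further `U 0` for each
  -- cycle still to return. The value `⊤` away from `l` does no harm, since the hitting time stops
  -- on exit.
  let V : State → ℝ≥0∞ := fun x => if x.loc = l then
    x.transit + (U x.stat + ((S.n l - x.cycles : ℕ) : ℝ≥0∞) * U 0) else ⊤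
  have hmain : S.meanHit (S.ExitEvent l) π x ≤ V x := by
    refine S.meanHit_le_of_drift π (S.measurable_hitTime_exit l)
      (G := S.Admissible) (fun x y h => h.step hγ y) (fun x hx => ?_) hx
    by_cases hxl : x.loc = l
    swap
    · simp [V, hxl]
    simp only [V, if_pos hxl]
    by_cases ht : x.transit = 0
    · set F : Meas s → ℝ≥0∞ := fun z => (if 0 < x.stat + S.Z l z then U (x.stat + S.Z l z) else 0)
        + ((S.n l - x.cycles : ℕ) : ℝ≥0∞) * U 0 with hF
      have hm : Measurable fun z =>
          (if 0 < x.stat + S.Z l z then U (x.stat + S.Z l z) else 0 : ℝ≥0∞) := by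
        have hz : Measurable fun z => x.stat + S.Z l z := (measurable_Z l).const_add _
        exact Measurable.ite (measurableSet_lt measurable_const hz) (hU.measurable.comp hz)
          measurable_const
      have hle : ∀ y : Loc → Meas s, (if S.ExitEvent l x y then 0 else
          if (S.step x y).loc = l then ((S.step x y).transit + (U (S.step x y).stat
            + ((S.n l - (S.step x y).cycles : ℕ) : ℝ≥0∞) * U 0) : ℝ≥0∞) else ⊤) ≤ F (y l) := by
        intro y
        by_cases he : S.ExitEvent l x y
        · rw [if_pos he]; exact zero_le
        have hloc : (S.step x y).loc = l := not_not.1 he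
        rw [if_neg he, if_pos hloc]
        simp only [step, update, hxl, ht, ne_eq, not_true_eq_false, if_false] at hloc ⊢
        split_ifs at hloc ⊢ with h2 h3 h4
        · exact absurd hloc (by simp [LSCD.depart, hxl, Loc.other_ne])
        · exact absurd hloc (by simp [LSCD.depart, hxl, Loc.other_ne])
        -- When a cycle returns to zero, one of the reserved summands `U 0` becomes the potential of
        -- the new cycle.
        · have h3' : ¬ 0 < x.stat + S.Z l (y l) := not_lt.2 ((le_max_left _ _).trans h3)
          have hn : S.n l - x.cycles = (S.n l - (x.cycles + 1)) + 1 := by omega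
          simp only [hF, if_neg h3', hn, Nat.cast_add, Nat.cast_one, Nat.cast_zero, zero_add]
          rw [add_mul, one_mul, add_comm]
        · have h3' : 0 < x.stat + S.Z l (y l) := by
            by_contra hc
            exact h3 (max_le (not_lt.1 hc) le_rfl)
          simp only [hF, if_pos h3', max_eq_left h3'.le, Nat.cast_zero, zero_add, le_refl]
      calc _ ≤ 1 + ∫⁻ y, F (y l) ∂slotLaw π := by
            gcongr with y; exact hle y
        _ = (1 + ∫⁻ z, (if 0 < x.stat + S.Z l z then U (x.stat + S.Z l z) else 0) ∂π l)
              + ((S.n l - x.cycles : ℕ) : ℝ≥0∞) * U 0 := by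
            rw [lintegral_slot_eval π l (hm.add_const _), lintegral_add_left hm, lintegral_const,
              measure_univ, mul_one, add_assoc]
        _ ≤ _ := by
            rw [ht, Nat.cast_zero, zero_add]
            exact add_le_add (hdrift _ hx.stat_nonneg) le_rfl
    · have hk : (x.transit : ℝ≥0∞) = 1 + (x.transit - 1 : ℕ) := by
        rw [← Nat.cast_one, ← Nat.cast_add]; congr 1; omega
      have he : ∀ y, ¬ S.ExitEvent l x y := fun y => by
        simp [ExitEvent, step_transit ht, hxl]
      simp only [he, if_false, step_transit ht, hxl, if_true, lintegral_const, measure_univ,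
        mul_one]
      rw [hk, add_assoc]
  simpa [V, hl] using hmain

/-- The mean remaining sojourn time at `l` depends on the law of the measurements at `l` only, and
is largest in the first cycle. -/
theorem meanHit_exit_mono {π' : Loc → Measure (Meas s)} [∀ l, IsProbabilityMeasure (π' l)]
    (hπ : π l = π' l) {c c' : ℕ} (hc : c' ≤ c) (w : ℝ) :
    S.meanHit (S.ExitEvent l) π ⟨l, 0, c, w⟩ ≤ S.meanHit (S.ExitEvent l) π' ⟨l, 0, c', w⟩ := by
  classical
  have hE := S.measurable_hitTime_exit l
  rw [S.meanHit_eq_iSup π hE, S.meanHit_eq_iSup π' hE]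
  refine iSup_mono fun N => ?_
  -- Both sojourns are driven by the same measurements: the statistics agree, and the one with more
  -- completed cycles cannot end later.
  induction N generalizing c c' w with
  | zero => simp [truncMean]
  | succ N ih =>
    rw [S.truncMean_succ π hE, S.truncMean_succ π' hE]
    set F : (Loc → Meas s) → ℝ≥0∞ := fun y => if S.ExitEvent l ⟨l, 0, c', w⟩ y then 1
      else 1 + S.truncMean (S.ExitEvent l) π' N (S.step ⟨l, 0, c', w⟩ y) with hF
    have hFm : Measurable F := S.measurable_truncMean_step π' hE N _
    -- Until exit only the measurement at `l` matters, which allows `π` to be replaced by `π'`.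
    have hFe : ∀ y, F y = F (fun _ => y l) := fun y => by
      have : S.step ⟨l, 0, c', w⟩ y = S.step ⟨l, 0, c', w⟩ fun _ => y l := step_congr rfl
      simp only [hF, ExitEvent, this]
      congr
    have hFm' : Measurable fun z : Meas s => F fun _ => z :=
      hFm.comp (measurable_pi_lambda _ fun _ => measurable_id)
    calc _ ≤ ∫⁻ y, F y ∂slotLaw π := by
          refine lintegral_mono fun y => ?_
          have ho := Loc.other_ne l
          simp only [hF, ExitEvent, step_sensing]
          by_cases h1 : S.γ l ≤ max (w + S.Z l (y l)) 0
          · simp [h1, ho]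
          by_cases h2 : max (w + S.Z l (y l)) 0 ≤ 0
          · by_cases h3 : S.n l ≤ c + 1
            · by_cases h4 : S.n l ≤ c' + 1
              · simp [h1, h2, h3, h4, ho]
              · simp [h1, h2, h3, h4, ho]
            · have h4 : ¬ S.n l ≤ c' + 1 := by omega
              simp only [if_neg h1, if_pos h2, if_neg h3, if_neg h4, ne_eq, not_true_eq_false,
                if_false]
              exact add_le_add le_rfl (ih (by omega) _)
          · simp only [if_neg h1, if_neg h2, ne_eq, not_true_eq_false, if_false]
            exact add_le_add le_rfl (ih hc _)
      _ = ∫⁻ y, F y ∂slotLaw π' := by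
          rw [lintegral_congr hFe, lintegral_congr (μ := slotLaw π') hFe,
            lintegral_slot_eval π l hFm', lintegral_slot_eval π' l hFm', hπ]

end Sojourn

/-! ### Mean time to alarm after the change -/

section Alarm

variable {l : Loc} {π : Loc → Measure (Meas s)} [∀ l, IsProbabilityMeasure (π l)]

/-- The mean time to alarm at `l`, in terms of the drift function `U` of the walk at `l`, the
Chernoff coefficient `ρ` of a failed cycle and the cost `κ` of an absence from `l`. -/
theorem meanHit_alarm_le (hγ : ∀ l, 0 < S.γ l) {U : ℝ → ℝ≥0∞} (hU : Monotone U)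
    (hdrift : ∀ u, 0 ≤ u → 1 + ∫⁻ z, (if S.Z l z < u then U (u - S.Z l z) else 0) ∂π l ≤ U u)
    {ρ κ β : ℝ} (hρ : ∫⁻ z, ENNReal.ofReal (Real.exp (-S.Z l z / 2)) ∂π l = ENNReal.ofReal ρ)
    (hκ0 : 0 ≤ κ) (hβ0 : 0 ≤ β) (hβ : (β + κ) * ρ ≤ β)
    (hκ : S.meanHit (S.ExitEvent l.other) π ⟨l.other, S.τ, 0, 0⟩ + S.τ ≤ ENNReal.ofReal κ)
    {R : ℝ≥0∞} (hR : ∀ x, S.Admissible x → x.loc = l.other →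
      S.meanHit (S.ExitEvent l.other) π x ≤ R) {x : State} (hx : S.Admissible x) :
    S.meanHit (S.AlarmEvent l) π x ≤ R + (S.τ + (U (S.γ l) + ENNReal.ofReal β)) := by
  classical
  -- `T` is the value of the potential `V` at the start of the trip back to `l`.
  set T : ℝ≥0∞ := S.τ + (U (S.γ l) + ENNReal.ofReal β) with hT
  -- At `l`, `U` of the distance to the threshold pays for the passage, and `β * exp (-stat / 2)`
  -- insures against failed cycles. Away from `l`, the exact mean time to exit is followed by `T`.
  let V : State → ℝ≥0∞ := fun x => if x.loc = l then
      x.transit + (U (S.γ l - x.stat) + ENNReal.ofReal (β * Real.exp (-x.stat / 2)))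
    else S.meanHit (S.ExitEvent l.other) π x + T
  have hVR : V x ≤ R + T := by
    by_cases hxl : x.loc = l
    · simp only [V, if_pos hxl]
      refine le_trans ?_ (le_add_self)
      refine add_le_add (by exact_mod_cast hx.transit_le) (add_le_add (hU ?_)
        (ENNReal.ofReal_le_ofReal ?_))
      · linarith [hx.stat_nonneg]
      · exact mul_le_of_le_one_right hβ0 (Real.exp_le_one_iff.2 (by linarith [hx.stat_nonneg]))
    · simp only [V, if_neg hxl]
      exact add_le_add (hR x hx (Loc.eq_other_of_ne hxl)) le_rfl
  refine le_trans ?_ hVR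
  refine S.meanHit_le_of_drift π (S.measurable_hitTime_alarm l)
    (G := S.Admissible) (fun x y h => h.step hγ y) (fun x hx => ?_) hx
  by_cases hxl : x.loc = l
  swap
  · have hxo := Loc.eq_other_of_ne hxl
    have hal : ∀ y, ¬ S.AlarmEvent l x y := fun y h => hxl h.1.1
    have hVs : ∀ y, V (S.step x y) = (if S.ExitEvent l.other x y then 0
        else S.meanHit (S.ExitEvent l.other) π (S.step x y)) + T := by
      intro y
      by_cases he : S.ExitEvent l.other x y
      · have hd : S.step x y = ⟨l, S.τ, 0, 0⟩ := by
          rw [step_eq_depart (by rw [hxo]; exact he), LSCD.depart, hxo, Loc.other_other]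
        simp [V, hd, he, hT]
      · have hloc : (S.step x y).loc = l.other := not_not.1 he
        have : (S.step x y).loc ≠ l := by rw [hloc]; exact Loc.other_ne l
        simp only [V, if_neg this, if_neg he]
    simp only [hal, if_false, hVs]
    rw [lintegral_add_right _ measurable_const, lintegral_const, measure_univ, mul_one,
      ← add_assoc]
    simp only [V, if_neg hxl]
    refine add_le_add (le_of_eq ?_) le_rfl
    rw [S.meanHit_eq π (S.measurable_hitTime_exit l.other) x]
    conv_lhs => rw [← mul_one (1 : ℝ≥0∞), ← measure_univ (μ := slotLaw π), ← lintegral_const,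
      ← lintegral_add_left measurable_const]
    refine lintegral_congr fun y => ?_
    split_ifs <;> simp
  have hVx : V x = x.transit + (U (S.γ l - x.stat)
      + ENNReal.ofReal (β * Real.exp (-x.stat / 2))) := if_pos hxl
  rw [hVx]
  by_cases ht : x.transit = 0
  swap
  · have hk : (x.transit : ℝ≥0∞) = 1 + (x.transit - 1 : ℕ) := by
      rw [← Nat.cast_one, ← Nat.cast_add]; congr 1; omega
    have he : ∀ y, ¬ S.AlarmEvent l x y := fun y h => ht h.1.2
    simp only [he, if_false, step_transit ht, V, hxl, if_true, lintegral_const, measure_univ,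
      mul_one]
    rw [hk, add_assoc]
  set w := x.stat with hw
  have hwl : w < S.γ l := hxl ▸ hx.stat_lt
  set a : ℝ := (β + κ) * Real.exp (-w / 2) with ha
  have ha0 : 0 ≤ a := by positivity
  set F₁ : Meas s → ℝ≥0∞ := fun z =>
    if S.Z l z < S.γ l - w then U (S.γ l - w - S.Z l z) else 0 with hF₁
  set F₂ : Meas s → ℝ≥0∞ := fun z => ENNReal.ofReal (Real.exp (-S.Z l z / 2)) with hF₂
  have hm₁ : Measurable F₁ := Measurable.ite (measurableSet_lt (measurable_Z l) measurable_const)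
    (hU.measurable.comp ((measurable_Z l).const_sub _)) measurable_const
  have hm₂ : Measurable F₂ := ((measurable_Z l).neg.div_const 2).exp.ennreal_ofReal
  have hae : ∀ z, a * Real.exp (-z / 2) = (β + κ) * Real.exp (-(w + z) / 2) := by
    intro z
    rw [ha, mul_assoc, ← Real.exp_add]
    congr 2; ring
  have hle : ∀ y : Loc → Meas s, (if S.AlarmEvent l x y then 0 else V (S.step x y))
      ≤ F₁ (y l) + ENNReal.ofReal a * F₂ (y l) := by
    intro y
    by_cases he : S.AlarmEvent l x y
    · rw [if_pos he]; exact zero_le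
    rw [if_neg he]
    have hna : ¬ S.γ l ≤ max (w + S.Z l (y l)) 0 := by
      intro h
      refine he ⟨⟨hxl, ht⟩, ?_⟩
      rw [update, hxl]; exact h
    have hz : S.Z l (y l) < S.γ l - w := by
      have := (le_max_left (w + S.Z l (y l)) 0).trans_lt (not_le.1 hna)
      linarith
    simp only [hF₁, hF₂, if_pos hz]
    rw [← ENNReal.ofReal_mul ha0, hae]
    have hna' : ¬ S.γ l ≤ max (x.stat + S.Z l (y l)) 0 := hna
    have hst : S.step x y = if max (w + S.Z l (y l)) 0 ≤ 0 then
        (if S.n x.loc ≤ x.cycles + 1 then S.depart x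
          else { x with cycles := x.cycles + 1, stat := 0 })
        else { x with stat := max (w + S.Z l (y l)) 0 } := by
      simp only [step, update, ht, hxl, ne_eq, not_true_eq_false, if_false,
        if_neg hna', hw]
    rw [hst]
    split_ifs with h3 h4
    · have h3' : w + S.Z l (y l) ≤ 0 := (le_max_left _ _).trans h3
      have hd : S.depart x = ⟨l.other, S.τ, 0, 0⟩ := by rw [LSCD.depart, hxl]
      -- A reset moves the walk up to zero, so the distance to the threshold only decreases. The
      -- exponential factor is at least 1 at or below zero and so covers `β + κ`: the new insurance
      -- and the whole absence.
      have hUm : U (S.γ l) ≤ U (S.γ l - w - S.Z l (y l)) := hU (by linarith)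
      have h1 : (1 : ℝ) ≤ Real.exp (-(w + S.Z l (y l)) / 2) := Real.one_le_exp (by linarith)
      have h2 : ENNReal.ofReal κ + ENNReal.ofReal β
          ≤ ENNReal.ofReal ((β + κ) * Real.exp (-(w + S.Z l (y l)) / 2)) := by
        rw [← ENNReal.ofReal_add hκ0 hβ0]
        refine ENNReal.ofReal_le_ofReal ?_
        rw [add_comm κ]
        exact le_mul_of_one_le_right (by positivity) h1
      simp only [V, hd, if_neg (Loc.other_ne l), hT]
      calc _ = U (S.γ l) + ((S.meanHit (S.ExitEvent l.other) π ⟨l.other, S.τ, 0, 0⟩ + S.τ)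
            + ENNReal.ofReal β) := by ring
        _ ≤ _ := add_le_add hUm ((add_le_add hκ le_rfl).trans h2)
    · have h3' : w + S.Z l (y l) ≤ 0 := (le_max_left _ _).trans h3
      have h1 : (1 : ℝ) ≤ Real.exp (-(w + S.Z l (y l)) / 2) := Real.one_le_exp (by linarith)
      simp only [V, hxl, if_true, ht, Nat.cast_zero, zero_add, sub_zero, neg_zero, zero_div,
        Real.exp_zero, mul_one]
      refine add_le_add (hU (by linarith)) (ENNReal.ofReal_le_ofReal ?_)
      exact (le_add_of_nonneg_right hκ0).trans (le_mul_of_one_le_right (by positivity) h1)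
    · have h3' : 0 < w + S.Z l (y l) := by
        by_contra hc
        exact h3 (max_le (not_lt.1 hc) le_rfl)
      simp only [V, hxl, if_true, ht, Nat.cast_zero, zero_add, max_eq_left h3'.le]
      refine add_le_add (le_of_eq (by rw [sub_sub])) (ENNReal.ofReal_le_ofReal ?_)
      exact mul_le_mul_of_nonneg_right (le_add_of_nonneg_right hκ0) (Real.exp_pos _).le
  calc _ ≤ 1 + ∫⁻ y, (F₁ (y l) + ENNReal.ofReal a * F₂ (y l)) ∂slotLaw π := by
        gcongr with y; exact hle y
    _ = (1 + ∫⁻ z, F₁ z ∂π l) + ENNReal.ofReal a * ENNReal.ofReal ρ := by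
        rw [lintegral_slot_eval π l (F := fun z => F₁ z + ENNReal.ofReal a * F₂ z)
          (hm₁.add (hm₂.const_mul _)), lintegral_add_left hm₁, lintegral_const_mul _ hm₂, hρ,
          add_assoc]
    _ ≤ U (S.γ l - w) + ENNReal.ofReal (β * Real.exp (-w / 2)) := by
        refine add_le_add (hdrift _ (by linarith)) ?_
        rw [← ENNReal.ofReal_mul ha0]
        refine ENNReal.ofReal_le_ofReal ?_
        calc a * ρ = (β + κ) * ρ * Real.exp (-w / 2) := by rw [ha]; ring
          _ ≤ _ := mul_le_mul_of_nonneg_right hβ (Real.exp_pos _).le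
    _ = _ := by rw [ht, Nat.cast_zero, zero_add]

end Alarm

end LSCD
end UAV

/-! ### Assembling the bounds -/

namespace UAV
namespace LSCD

theorem exists_WADD_bound {s : ℕ} (f g : Loc → Measure (Meas s))
    [∀ l, IsProbabilityMeasure (f l)] [∀ l, IsProbabilityMeasure (g l)]
    (hfg : ∀ l, (f l).AbsolutelyContinuous (g l)) (hgf : ∀ l, (g l).AbsolutelyContinuous (f l))
    (hne : ∀ l, f l ≠ g l) (hf2 : ∀ l, MemLp (llr (g l) (f l)) 2 (f l))
    (hg2 : ∀ l, MemLp (llr (g l) (f l)) 2 (g l)) (τ n : ℕ) (l : Loc) :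
    ∃ K : ℝ, ∀ γ : Loc → ℝ, (∀ l, 0 < γ l) → ∀ S : LSCD s, S = ⟨f, g, τ, fun _ => n, γ⟩ →
      ∀ l₀ : Loc,
        S.WADD (State.fresh l₀) l
          ≤ ENNReal.ofReal (γ l / S.Dgf l + γ l.other / S.Dfg l.other + K) ∧
        ((∀ v ∈ Ico 0 (γ l.other), S.meanRemSojourn l.other v ≤ S.meanRemSojourn l.other 0) →
          S.WADD (State.fresh l₀) l ≤ ENNReal.ofReal (γ l / S.Dgf l + K)) := by
  obtain ⟨⟨U, hU, K₁, hK₁, hUK, hUd⟩, ρ, hρ0, hρ1, hρ⟩ :=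
    exists_llr_supersolution (hfg l) (hgf l) (hne l) (hg2 l)
  obtain ⟨U', hU', K₂, hK₂, hUK', hUd'⟩ :=
    exists_neg_llr_supersolution (hfg l.other) (hgf l.other) (hne l.other) (hf2 l.other)
  -- An absence consists of two trips and a fresh sojourn of mean at most `(n + 1) * K₂`; `β` below
  -- solves `(β + κ) * ρ = β`.
  set κ : ℝ := 2 * τ + (n + 1) * K₂ with hκ
  have hκ0 : 0 ≤ κ := by positivity
  set β : ℝ := κ * ρ / (1 - ρ) with hβ
  have hβ0 : 0 ≤ β := div_nonneg (mul_nonneg hκ0 hρ0) (by linarith)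
  have hββ : (β + κ) * ρ ≤ β := by
    have : (1 - ρ) ≠ 0 := by linarith
    rw [hβ]
    refine le_of_eq ?_
    field_simp
    ring
  refine ⟨κ + K₁ + β, fun γ hγ S hS l₀ => ?_⟩
  have hSf : S.f = f := by rw [hS]
  have hSg : S.g = g := by rw [hS]
  have hSτ : S.τ = τ := by rw [hS]
  have hSn : ∀ k, S.n k = n := fun k => by rw [hS]
  have hSγ : S.γ = γ := by rw [hS]
  have : ∀ k, IsProbabilityMeasure (S.f k) := fun k => by rw [hSf]; infer_instance
  have : ∀ k, IsProbabilityMeasure (S.g k) := fun k => by rw [hSg]; infer_instance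
  have hγ' : ∀ k, 0 < S.γ k := by rwa [hSγ]
  have hDg : (InformationTheory.klDiv (g l) (f l)).toReal = S.Dgf l := by rw [Dgf, hSf, hSg]
  have hDf : (InformationTheory.klDiv (f l.other) (g l.other)).toReal = S.Dfg l.other := by
    rw [Dfg, hSf, hSg]
  have hDf0 : 0 ≤ S.Dfg l.other := ENNReal.toReal_nonneg
  have hDg0 : 0 ≤ S.Dgf l := ENNReal.toReal_nonneg
  rw [hDg] at hUK
  rw [hDf] at hUK'
  let π : Loc → Measure (Meas s) := fun k => if k = l then S.g l else S.f k
  have hπl : π l = g l := by simp only [π, if_true, hSg]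
  have hπo : π l.other = S.f l.other := if_neg (Loc.other_ne l)
  -- Stated for every law that is `f` at `l.other`, since it is used under the change at `l` and
  -- under no change.
  have hexit : ∀ (μ : Loc → Measure (Meas s)) [∀ k, IsProbabilityMeasure (μ k)],
      μ l.other = f l.other → ∀ x, S.Admissible x → x.loc = l.other →
      S.meanHit (S.ExitEvent l.other) μ x
        ≤ ENNReal.ofReal (x.stat / S.Dfg l.other + (τ + (n + 1) * K₂)) := by
    intro μ _ hμ x hx hxl
    have hdr : ∀ u, 0 ≤ u → 1 + ∫⁻ z, (if 0 < u + S.Z l.other z then U' (u + S.Z l.other z)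
        else 0) ∂μ l.other ≤ U' u := by
      simpa only [hμ, LSCD.Z, hSf, hSg] using hUd'
    refine (meanHit_exit_le hγ' hU' hdr hx hxl).trans ?_
    have h0 : U' 0 ≤ ENNReal.ofReal K₂ := by simpa using hUK' 0 le_rfl
    have hd : 0 ≤ x.stat / S.Dfg l.other := div_nonneg hx.stat_nonneg hDf0
    have e : x.stat / S.Dfg l.other + (τ + (n + 1) * K₂)
        = τ + ((x.stat / S.Dfg l.other + K₂) + n * K₂) := by ring
    rw [e, ENNReal.ofReal_add (by positivity) (by positivity),
      ENNReal.ofReal_add (by positivity) (by positivity), ENNReal.ofReal_mul (by positivity),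
      ENNReal.ofReal_natCast, ENNReal.ofReal_natCast]
    refine add_le_add ?_ (add_le_add (hUK' _ hx.stat_nonneg) (mul_le_mul' ?_ h0))
    · rw [← hSτ]; exact_mod_cast hx.transit_le
    · rw [hSn]; exact_mod_cast Nat.sub_le _ _
  have hκm : S.meanHit (S.ExitEvent l.other) π ⟨l.other, S.τ, 0, 0⟩ + S.τ
      ≤ ENNReal.ofReal κ := by
    have h := hexit π (by rw [hπo, hSf]) _ (Admissible.arrival hγ' l.other) rfl
    refine (add_le_add h le_rfl).trans (le_of_eq ?_)
    rw [hSτ, ← ENNReal.ofReal_natCast τ, ← ENNReal.ofReal_add (by positivity) (by positivity), hκ]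
    congr 1
    simp only [zero_div]; ring
  have hdrift : ∀ u, 0 ≤ u →
      1 + ∫⁻ z, (if S.Z l z < u then U (u - S.Z l z) else 0) ∂π l ≤ U u := by
    simpa only [hπl, LSCD.Z, hSf, hSg] using hUd
  have hρ' : ∫⁻ z, ENNReal.ofReal (Real.exp (-S.Z l z / 2)) ∂π l = ENNReal.ofReal ρ := by
    simpa only [hπl, LSCD.Z, hSf, hSg] using hρ
  -- Here `r` bounds the first sojourn at `l.other`, the only one that may be met at a high
  -- statistic; later absences are already paid for in `β`.
  have hmain : ∀ r : ℝ, 0 ≤ r → (∀ x, S.Admissible x → x.loc = l.other →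
      S.meanHit (S.ExitEvent l.other) π x ≤ ENNReal.ofReal r) →
      S.WADD (State.fresh l₀) l ≤ ENNReal.ofReal (r + (τ + ((γ l / S.Dgf l + K₁) + β))) := by
    intro r hr hR
    refine S.WADD_le (G := S.Admissible) (fun x y h => h.step hγ' y) (fun x hx => ?_)
      (Admissible.fresh hγ' l₀)
    rw [lawChange_zero]
    refine (meanHit_alarm_le hγ' hU hdrift hρ' hκ0 hβ0 hββ hκm hR hx).trans ?_
    have hd : 0 ≤ γ l / S.Dgf l := div_nonneg (hγ l).le hDg0
    rw [ENNReal.ofReal_add hr (by positivity), ENNReal.ofReal_add (by positivity) (by positivity),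
      ENNReal.ofReal_add (by positivity) hβ0, ENNReal.ofReal_natCast, hSτ, hSγ]
    gcongr
    exact hUK _ (hγ l).le
  constructor
  · have hd : 0 ≤ γ l.other / S.Dfg l.other := div_nonneg (hγ _).le hDf0
    refine (hmain (γ l.other / S.Dfg l.other + (τ + (n + 1) * K₂)) (by positivity)
      fun x hx hxl => ?_).trans (ENNReal.ofReal_le_ofReal (le_of_eq (by rw [hκ]; ring)))
    refine (hexit π (by rw [hπo, hSf]) x hx hxl).trans (ENNReal.ofReal_le_ofReal ?_)
    have := hx.stat_lt
    rw [hxl, hSγ] at this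
    gcongr
  · intro hmax
    refine (hmain (τ + (n + 1) * K₂) (by positivity)
      fun x hx hxl => ?_).trans (ENNReal.ofReal_le_ofReal (le_of_eq (by rw [hκ]; ring)))
    -- An interrupted sojourn is compared with one in its first cycle at the same level, and then by
    -- `hmax` with a fresh one, whose mean does not involve the threshold. During travel the
    -- statistic is zero.
    by_cases ht : x.transit = 0
    · have hlt := hx.stat_lt
      rw [hxl] at hlt
      have hx' : x = ⟨l.other, 0, x.cycles, x.stat⟩ := by rw [← hxl, ← ht]
      have h0 := hexit S.f (by rw [hSf]) (State.fresh l.other) (Admissible.fresh hγ' _) rfl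
      calc S.meanHit (S.ExitEvent l.other) π x
          = S.meanHit (S.ExitEvent l.other) π ⟨l.other, 0, x.cycles, x.stat⟩ := by rw [← hx']
        _ ≤ S.meanHit (S.ExitEvent l.other) S.f ⟨l.other, 0, 0, x.stat⟩ :=
            meanHit_exit_mono hπo (Nat.zero_le _) _
        _ = S.meanRemSojourn l.other x.stat := (S.meanRemSojourn_eq_meanHit hlt).symm
        _ ≤ S.meanRemSojourn l.other 0 := hmax _ ⟨hx.stat_nonneg, by rwa [hSγ] at hlt⟩
        _ = S.meanHit (S.ExitEvent l.other) S.f (State.fresh l.other) :=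
            S.meanRemSojourn_eq_meanHit (hγ' _)
        _ ≤ _ := by simpa [State.fresh] using h0
    · have h := hexit π (by rw [hπo, hSf]) x hx hxl
      rwa [hx.stat_eq ht, zero_div, zero_add] at h

/-- `C₁` is bounded below uniformly in `w`. -/
theorem exists_le_C₁ {s : ℕ} (S : LSCD s) (l : Loc) : ∃ c, ∀ w, 0 ≤ w → c ≤ S.C₁ l w := by
  set a : ℝ := S.τ * ((1 + S.qbar l ^ S.n l) / (1 - S.qbar l ^ S.n l))
  set b : ℝ := 1 + S.meanPos l.other / S.Dfg l.other
  set d : ℝ := S.n l * S.qbar l ^ S.n l / (1 - S.qbar l ^ S.n l)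
  set e : ℝ := (S.n l : ℝ) - 1
  set h : ℝ := 1 / 2 * Real.exp (-S.Dfg l.other)
  refine ⟨a + b * (d + e * (1 - h)) - |b * e|, fun w hw => ?_⟩
  have h1 : Real.exp (-w) ≤ 1 := Real.exp_le_one_iff.2 (by linarith)
  have h2 : |b * e * Real.exp (-w)| ≤ |b * e| := by
    rw [abs_mul, abs_of_pos (Real.exp_pos _)]
    exact mul_le_of_le_one_right (abs_nonneg _) h1
  have h3 := neg_abs_le (b * e * Real.exp (-w))
  have h4 : S.C₁ l w = a + b * (d + e * (1 - h)) + b * e * Real.exp (-w) := by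
    rw [C₁]; ring
  rw [h4]
  linarith

theorem meanRemSojourn_threshold {s : ℕ} (S : LSCD s) (l : Loc) :
    S.meanRemSojourn l (S.γ l) = 0 := by
  simp [meanRemSojourn, remSojourn]

end LSCD
end UAV

theorem mainTheorem3 {s : ℕ} (f g : UAV.Loc → Measure (UAV.Meas s))
    [∀ l, IsProbabilityMeasure (f l)] [∀ l, IsProbabilityMeasure (g l)]
    (hfg : ∀ l, (f l).AbsolutelyContinuous (g l))
    (hgf : ∀ l, (g l).AbsolutelyContinuous (f l))
    (hne : ∀ l, f l ≠ g l)
    (hf2 : ∀ l, MemLp (llr (g l) (f l)) 2 (f l))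
    (hg2 : ∀ l, MemLp (llr (g l) (f l)) 2 (g l))
    (τ n : ℕ) (hn : 1 ≤ n) :
    ∃ K : ℝ, ∀ γ : UAV.Loc → ℝ, (∀ l, 0 < γ l) →
      ∀ S : UAV.LSCD s, S = ⟨f, g, τ, fun _ => n, γ⟩ →
      ∀ l₀ l : UAV.Loc,
        (∀ w ∈ Ioo 0 (γ l.other),
          IsMaxOn (S.meanRemSojourn l.other) (Ioo 0 (γ l.other)) w →
          S.WADD (UAV.State.fresh l₀) l
            ≤ ENNReal.ofReal (γ l / S.Dgf l + S.C' l w + K)) ∧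
        (∀ w ∈ Icc 0 (γ l.other),
          IsMaxOn (S.meanRemSojourn l.other) (Icc 0 (γ l.other)) w →
          w ∉ Ioo 0 (γ l.other) →
          S.WADD (UAV.State.fresh l₀) l
            ≤ ENNReal.ofReal (γ l / S.Dgf l + S.C₂ l + K)) := by
  -- `C₁` and `C₂` do not involve the thresholds, so they can be evaluated at thresholds 1; this
  -- makes `K` uniform in `γ`.
  let S₀ : UAV.LSCD s := ⟨f, g, τ, fun _ => n, fun _ => 1⟩
  choose K hK using fun l => UAV.LSCD.exists_WADD_bound f g hfg hgf hne hf2 hg2 τ n l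
  choose c hc using fun l => UAV.LSCD.exists_le_C₁ S₀ l
  have hfin : ∃ M : ℝ, ∀ l : UAV.Loc, K l - c l ≤ M ∧ K l - S₀.C₂ l ≤ M := by
    refine ⟨max (max (K .A - c .A) (K .A - S₀.C₂ .A)) (max (K .B - c .B) (K .B - S₀.C₂ .B)),
      fun l => ?_⟩
    cases l <;> simp
  obtain ⟨M, hM⟩ := hfin
  refine ⟨M, fun γ hγ S hS l₀ l => ?_⟩
  obtain ⟨h1, h2⟩ := hK l γ hγ S hS l₀
  have hC₁ : ∀ w, S.C₁ l w = S₀.C₁ l w := fun w => by rw [hS]; rfl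
  have hC₂ : S.C₂ l = S₀.C₂ l := by rw [hS]; rfl
  have hSγ : S.γ = γ := by rw [hS]
  obtain ⟨hM1, hM2⟩ := hM l
  constructor
  · intro w hw _
    refine h1.trans (ENNReal.ofReal_le_ofReal ?_)
    have h3 : S.C₁ l w + S.γ l.other / S.Dfg l.other ≤ S.C' l w := le_max_left _ _
    have h4 := hc l w hw.1.le
    rw [hC₁, hSγ] at h3
    linarith
  · intro w hw hmax hwn
    -- A maximizer on the closed interval outside the open one is `0` or the threshold. At the
    -- threshold the mean is `0`, so the mean vanishes on the whole interval and `0` is a maximizer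
    -- as well.
    have hm : ∀ v ∈ Ico 0 (γ l.other),
        S.meanRemSojourn l.other v ≤ S.meanRemSojourn l.other 0 := by
      intro v hv
      have hv' : S.meanRemSojourn l.other v ≤ S.meanRemSojourn l.other w :=
        hmax ⟨hv.1, hv.2.le⟩
      rcases hw.1.eq_or_lt with h0 | h0
      · rwa [← h0] at hv'
      · have hwγ : w = S.γ l.other := by
          rw [hSγ]
          exact le_antisymm hw.2 (not_lt.1 fun h => hwn ⟨h0, h⟩)
        rw [hwγ, UAV.LSCD.meanRemSojourn_threshold] at hv'
        exact hv'.trans zero_le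
    refine (h2 hm).trans (ENNReal.ofReal_le_ofReal ?_)
    rw [hC₂]
    linarith
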